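/- Consider a random effects model with parameter $\theta$: latent variables $X_t$ in $\mathbb{R}^k$ have density $f_\theta$, and given $X_t=x$ the observation $Y_t$ has density $g_\theta(\cdot\mid x)$ with respect to a $\sigma$-finite reference measure. The likelihood is $p(y_{1:T}\mid\theta)=\prod_{t=1}^T p(y_t\mid\theta)$ with $p(y\mid\theta)=\int g_\theta(y\mid x)f_\theta(x)\,\mathrm{d}x$. It is estimated by importance sampling: let $q_\theta(\cdot\mid y)$ be a proposal density on $\mathbb{R}^k$ and $\Xi$ a deterministic map such that $\Xi(y,V;\theta)\sim q_\theta(\cdot\mid y)$ when $V\sim\mathcal{N}(0_p,I_p)$, and put $$\omega(y,u;\theta)=\frac{g_\theta(y\mid x)f_\theta(x)}{q_\theta(x\mid y)}\Big|_{x=\Xi(y,u;\theta)},\qquad \varpi(y,u;\theta)=\frac{\omega(y,u;\theta)}{p(y\mid\theta)},$$ $$\widehat p(y\mid\theta,u_{1:N})=\frac1N\sum_{i=1}^N\omega(y,u_i;\theta),\qquad \widehat p(y_{1:T}\mid\theta,u)=\prod_{t=1}^T\widehat p(y_t\mid\theta,u_t).$$ Let $\mu$ be a probability measure on the observation space such that,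 for $\mu$-almost every $y$, $0<p(y\mid\theta)<\infty$ and $g_\theta(y\mid x)f_\theta(x)=0$ for almost every $x$ with $q_\theta(x\mid y)=0$ (so that the estimator is unbiased). Let $Y_1,Y_2,\dots$ be i.i.d. with law $\mu$, let $\mathcal{Y}^T=\sigma(Y_1,\dots,Y_T)$, and let $N_T=\lceil\beta T^\alpha\rceil$ with $1/3<\alpha\le1$ and $\beta>0$. For each $T$ let $U=U^T=(U_{t,i})_{t\le T,\,i\le N_T}$ be random with $U_{t,i}\in\mathbb{R}^p$, and define $$Z_T(\theta)=\log\widehat p(Y_{1:T}\mid\theta,U)-\log p(Y_{1:T}\mid\theta).$$ Write $\gamma(y;\theta)^2=\mathbb{V}(\varpi(y,V;\theta))$ and $\gamma(\theta)^2=\mathbb{V}(\varpi(Y_1,V;\theta))$, where $V\sim\mathcal{N}(0_p,I_p)$ is independent of $Y_1$. Write $M^T\mid\mathcal{Y}^T\Rightarrow\lambda$ if $\mathbb{E}[f(M^T)\mid\mathcal{Y}^T]\to\int f\,\mathrm{d}\lambda$ in probability as $T\to\infty$ for every bounded continuous $f$. $\mathcal{N}(0,0)$ is the point mass at $0$. 1.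 If $\mathbb{E}(\varpi(Y_1,V;\theta)^8)<\infty$ and, for each $T$, $U\sim m$, i.e. the $U_{t,i}$ are i.i.d. $\mathcal{N}(0_p,I_p)$ and independent of $Y_{1:T}$, then $$T^{(\alpha-1)/2}Z_T(\theta)+\tfrac12T^{(1-\alpha)/2}\beta^{-1}\gamma(\theta)^2\;\Big|\;\mathcal{Y}^T\;\Rightarrow\;\mathcal{N}\bigl(0,\beta^{-1}\gamma(\theta)^2\bigr).$$ 2. If $\mathbb{E}(\varpi(Y_1,V;\theta)^9)+\mathbb{E}(\gamma(Y_1;\theta)^4)<\infty$ and, for each $T$, $U\sim\bar\pi(\cdot\mid\theta)$, i.e. given $Y_{1:T}$ the law of $U$ has density $\bar\pi(u\mid\theta)=\prod_{t=1}^T\frac{\widehat p(Y_t\mid\theta,u_t)}{p(Y_t\mid\theta)}\,\varphi(u_t;0_{pN_T},I_{pN_T})$, where $\varphi(\cdot;0_n,I_n)$ is the standard normal density on $\mathbb{R}^n$, then $$T^{(\alpha-1)/2}Z_T(\theta)-\tfrac12T^{(1-\alpha)/2}\beta^{-1}\gamma(\theta)^2\;\Big|\;\mathcal{Y}^T\;\Rightarrow\;\mathcal{N}\bigl(0,\beta^{-1}\gamma(\theta)^2\bigr).$$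 -/

import Mathlib

open MeasureTheory ProbabilityTheory Filter Topology
open scoped BoundedContinuousFunction ENNReal

noncomputable section

/-- Conditional weak convergence `M T | 𝒢 T ⇒ lam` on a common probability space: for every bounded
continuous `f`, `𝔼[f (M T) | 𝒢 T] → ∫ f dlam` in probability. -/
def CondTendstoInLaw {Ω : Type*} [MeasurableSpace Ω] (P : Measure Ω)
    (𝒢 : ℕ → MeasurableSpace Ω) (M : ℕ → Ω → ℝ) (lam : Measure ℝ) : Prop :=
  ∀ f : ℝ →ᵇ ℝ,
    TendstoInMeasure P (fun T => P[fun ω => f (M T ω) | 𝒢 T]) atTop (fun _ => ∫ x, f x ∂lam)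

/-- The standard normal law `𝒩(0_p, I_p)` on `ℝ^p`. -/
def stdNormal (p : ℕ) : Measure (Fin p → ℝ) :=
  Measure.pi fun _ => gaussianReal 0 1

/-- A random effects model with `ℝ^k`-valued latent variables and `E`-valued observations:
`X ∼ f_θ` (density with respect to Lebesgue measure) and `Y | X = x ∼ g_θ(· | x)` (density with
respect to a σ-finite reference measure `ν`). The value `g θ y x` is `g_θ(y | x)`. -/
structure RandomEffectsModel (Θ E : Type*) [MeasurableSpace E] (k : ℕ) where
  f : Θ → (Fin k → ℝ) → ℝ
  f_nonneg : ∀ θ x, 0 ≤ f θ x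
  f_measurable : ∀ θ, Measurable (f θ)
  f_density : ∀ θ, ∫⁻ x, ENNReal.ofReal (f θ x) = 1
  ν : Measure E
  ν_sigmaFinite : SigmaFinite ν
  g : Θ → E → (Fin k → ℝ) → ℝ
  g_nonneg : ∀ θ y x, 0 ≤ g θ y x
  g_measurable : ∀ θ, Measurable fun z : E × (Fin k → ℝ) => g θ z.1 z.2
  g_density : ∀ θ x, ∫⁻ y, ENNReal.ofReal (g θ y x) ∂ν = 1

/-- An importance sampling scheme on `ℝ^k`: proposal densities `q_θ(x | y)` (written `q θ y x`) and
a deterministic map `Ξ` transforming `U ∼ 𝒩(0_p, I_p)` into `Ξ(y, U; θ) ∼ q_θ(· | y)`. -/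
structure ImportanceSampler (Θ E : Type*) [MeasurableSpace E] (k p : ℕ) where
  q : Θ → E → (Fin k → ℝ) → ℝ
  q_nonneg : ∀ θ y x, 0 ≤ q θ y x
  q_measurable : ∀ θ, Measurable fun z : E × (Fin k → ℝ) => q θ z.1 z.2
  Ξ : Θ → E → (Fin p → ℝ) → (Fin k → ℝ)
  Ξ_measurable : ∀ θ, Measurable fun z : E × (Fin p → ℝ) => Ξ θ z.1 z.2
  Ξ_law : ∀ θ y,
    (stdNormal p).map (Ξ θ y) = volume.withDensity fun x => ENNReal.ofReal (q θ y x)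

section Estimator

variable {Θ E : Type*} [MeasurableSpace E] {k p : ℕ}

/-- The likelihood of one observation, `p(y | θ) = ∫ g_θ(y | x) f_θ(x) dx`. -/
def RandomEffectsModel.lik (R : RandomEffectsModel Θ E k) (θ : Θ) (y : E) : ℝ :=
  ∫ x, R.g θ y x * R.f θ x

/-- The importance weight `ω(y, u; θ) = g_θ(y | x) f_θ(x) / q_θ(x | y)` at `x = Ξ(y, u; θ)`. -/
def impWeight (R : RandomEffectsModel Θ E k) (S : ImportanceSampler Θ E k p)
    (θ : Θ) (y : E) (u : Fin p → ℝ) : ℝ :=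
  R.g θ y (S.Ξ θ y u) * R.f θ (S.Ξ θ y u) / S.q θ y (S.Ξ θ y u)

/-- The normalized importance weight `ϖ(y, u; θ) = ω(y, u; θ) / p(y | θ)`. -/
def normWeight (R : RandomEffectsModel Θ E k) (S : ImportanceSampler Θ E k p)
    (θ : Θ) (y : E) (u : Fin p → ℝ) : ℝ :=
  impWeight R S θ y u / R.lik θ y

/-- `γ(y; θ)²`, the variance of `ϖ(y, U; θ)` for fixed `y` and `U ∼ 𝒩(0_p, I_p)`. -/
def condGammaSq (R : RandomEffectsModel Θ E k) (S : ImportanceSampler Θ E k p)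
    (θ : Θ) (y : E) : ℝ :=
  Var[fun u => normWeight R S θ y u; stdNormal p]

/-- `γ(θ)²`, the variance of `ϖ(Y, U; θ)` for independent `Y ∼ μ` and `U ∼ 𝒩(0_p, I_p)`. -/
def gammaSq (R : RandomEffectsModel Θ E k) (S : ImportanceSampler Θ E k p)
    (μ : Measure E) (θ : Θ) : ℝ :=
  Var[fun z : E × (Fin p → ℝ) => normWeight R S θ z.1 z.2; μ.prod (stdNormal p)]

/-- The estimator `p̂(y | θ, u) = N⁻¹ ∑ᵢ ω(y, uᵢ; θ)` of the likelihood of one observation. -/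
def likEst (R : RandomEffectsModel Θ E k) (S : ImportanceSampler Θ E k p) (θ : Θ)
    {N : ℕ} (y : E) (u : Fin N → Fin p → ℝ) : ℝ :=
  (N : ℝ)⁻¹ * ∑ i, impWeight R S θ y (u i)

/-- The loglikelihood error `log p̂(y_{1:T} | θ, u) - log p(y_{1:T} | θ)`. -/
def loglikError (R : RandomEffectsModel Θ E k) (S : ImportanceSampler Θ E k p) (θ : Θ)
    {T N : ℕ} (y : Fin T → E) (u : Fin T → Fin N → Fin p → ℝ) : ℝ :=
  Real.log (∏ t, likEst R S θ (y t) (u t)) - Real.log (∏ t, R.lik θ (y t))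

/-- The joint law of `(Y_{1:T}, U)` when `Y_t` are i.i.d. `μ` and, independently, `U ∼ m`, i.e. the
`U_{t,i}` are i.i.d. `𝒩(0_p, I_p)`. -/
def proposalLaw (μ : Measure E) (p T N : ℕ) :
    Measure ((Fin T → E) × (Fin T → Fin N → Fin p → ℝ)) :=
  (Measure.pi fun _ => μ).prod (Measure.pi fun _ => Measure.pi fun _ => stdNormal p)

/-- The joint law of `(Y_{1:T}, U)` when `Y_t` are i.i.d. `μ` and, given `Y_{1:T}`, the conditional
law of `U` is `π̄(· | θ)`, whose density with respect to the law `m` of i.i.d. standard normal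
variables is `∏ₜ p̂(Y_t | θ, u_t) / p(Y_t | θ)`. -/
def equilibriumLaw (R : RandomEffectsModel Θ E k) (S : ImportanceSampler Θ E k p)
    (μ : Measure E) (θ : Θ) (T N : ℕ) :
    Measure ((Fin T → E) × (Fin T → Fin N → Fin p → ℝ)) :=
  (proposalLaw μ p T N).withDensity fun z =>
    ENNReal.ofReal (∏ t, likEst R S θ (z.1 t) (z.2 t) / R.lik θ (z.1 t))

end Estimator

/-- The number of importance samples `N_T = ⌈β T^α⌉`. -/
def numSamples (β α : ℝ) (T : ℕ) : ℕ := ⌈β * (T : ℝ) ^ α⌉₊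

/-- The first `T` observations `Y_{1:T}`, as one random vector. -/
def firstObs {Ω E : Type*} (Y : ℕ → Ω → E) (T : ℕ) (ω : Ω) : Fin T → E := fun t => Y t ω

/-- The σ-field `𝒴^T` spanned by `Y_{1:T}`. -/
abbrev obsSigma {Ω E : Type*} [MeasurableSpace E] (Y : ℕ → Ω → E) (T : ℕ) : MeasurableSpace Ω :=
  MeasurableSpace.comap (firstObs Y T) inferInstance

end

/-! The proof works with characteristic functions conditional on the observations. Put `a = T ^ ((α
- 1) / 2)`, `b = s * a`, and `e_t` for the average of the centred weights `ϖ - 1` at observation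
`t`, so that `p̂ / p = ∏ (1 + e_t)`. Given the data the `e_t` are independent, and the density of
`π̄` is this same product. Both regimes are therefore one computation: up to the event that some `1
+ e_t` vanishes, the conditional characteristic function of `a * Z_T` is `∏ E (1 + e_t) ^ z` with `z
= j + i b`, where `j = 0` for `m` and `j = 1` for `π̄`.

A cubic Taylor expansion gives `E (1 + e_t) ^ z ≈ exp (z (z - 1) / 2 * m2 / N)`, where `m2` is the
variance of the weight at that observation. As `z` or `z - 1` equals `i b`, the coefficients from
order two on carry a factor `|b|`, and the error is `O(|b| / N ^ 2 + 1 / N ^ 3)` per observation.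
Over `T` observations this is of order `T ^ ((1 - 3α) / 2)` at most, whence `α > 1/3`. The exponent
`z (z - 1) / 2 = -b ^ 2 / 2 + (2 j - 1) i b / 2` yields the Gaussian variance and, in its imaginary
part, a drift whose sign depends on `j`. The sum of the `m2` is replaced by `T γ²` at the cost of an
i.i.d. fluctuation of order `√T`, and `N` by `β T ^ α` at the cost of rounding.

All errors are bounded in `L¹` over the data (`integral_norm_condCharFun_sub_le`). The passage from
`L¹` convergence of conditional characteristic functions to conditional weak convergence is
`tendstoInMeasure_of_charFun`, which applies Lévy's theorem in the plane to pairs of conditionally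
independent copies. -/

/-! ### Weak convergence in probability from random characteristic functions. -/

/-- The mixture over `P` of the laws of pairs of conditionally independent draws from `κ`. -/
noncomputable def pairMixture {Ω : Type*} [MeasurableSpace Ω] (P : Measure Ω) (κ : Kernel Ω ℝ) :
    Measure (WithLp 2 (ℝ × ℝ)) :=
  (P ⊗ₘ (κ ×ₖ κ)).map fun z => WithLp.toLp 2 z.2

section PairMixture

variable {Ω : Type*} [MeasurableSpace Ω] {P : Measure Ω} [IsProbabilityMeasure P]

lemma measurable_toLp_snd :
    Measurable fun z : Ω × (ℝ × ℝ) => (WithLp.toLp 2 z.2 : WithLp 2 (ℝ × ℝ)) :=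
  (WithLp.measurable_toLp 2 (ℝ × ℝ)).comp measurable_snd

instance isProbabilityMeasure_pairMixture (κ : Kernel Ω ℝ) [IsMarkovKernel κ] :
    IsProbabilityMeasure (pairMixture P κ) :=
  Measure.isProbabilityMeasure_map measurable_toLp_snd.aemeasurable

lemma integral_pairMixture (κ : Kernel Ω ℝ) [IsMarkovKernel κ] {F : Type*} [NormedAddCommGroup F]
    [NormedSpace ℝ F] {g : WithLp 2 (ℝ × ℝ) → F} (hg : StronglyMeasurable g)
    {C : ℝ} (hC : ∀ x, ‖g x‖ ≤ C) :
    ∫ x, g x ∂(pairMixture P κ)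
      = ∫ ω, ∫ x, g (WithLp.toLp 2 x) ∂((κ ω).prod (κ ω)) ∂P := by
  rw [pairMixture, integral_map measurable_toLp_snd.aemeasurable hg.aestronglyMeasurable,
    Measure.integral_compProd]
  · simp_rw [Kernel.prod_apply]
  · refine Integrable.of_bound (hg.comp_measurable measurable_toLp_snd).aestronglyMeasurable C
      (ae_of_all _ fun z => hC _)

/-- Given `ω` the two draws are independent, so the characteristic function factors before
averaging. `WithLp 2` supplies the inner product on the plane that `charFun` requires. -/
lemma charFun_pairMixture (κ : Kernel Ω ℝ) [IsMarkovKernel κ] (t : WithLp 2 (ℝ × ℝ)) :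
    charFun (pairMixture P κ) t = ∫ ω, charFun (κ ω) t.fst * charFun (κ ω) t.snd ∂P := by
  rw [charFun, integral_pairMixture κ (C := 1)]
  · refine integral_congr_ae (ae_of_all _ fun ω => ?_)
    have := charFun_prod (μ := κ ω) (ν := κ ω) t
    rw [charFun, integral_map] at this
    · exact this
    · exact (WithLp.measurable_toLp 2 (ℝ × ℝ)).aemeasurable
    · exact (by fun_prop : Continuous _).aestronglyMeasurable
  · exact (by fun_prop : Continuous _).stronglyMeasurable
  · intro x
    rw [Complex.norm_exp_ofReal_mul_I]

lemma measurable_charFun_kernel (κ : Kernel Ω ℝ) [IsMarkovKernel κ] (t : ℝ) :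
    Measurable fun ω => charFun (κ ω) t := by
  refine (StronglyMeasurable.integral_kernel (κ := κ)
    (f := fun x : ℝ => Complex.exp (inner ℝ x t * Complex.I)) ?_).measurable
  exact (by fun_prop : Continuous _).stronglyMeasurable

lemma measurable_integral_kernel (κ : Kernel Ω ℝ) [IsMarkovKernel κ] (f : ℝ →ᵇ ℝ) :
    Measurable fun ω => ∫ x, f x ∂(κ ω) :=
  (StronglyMeasurable.integral_kernel (κ := κ) (f := f)
    f.continuous.stronglyMeasurable).measurable

lemma norm_mul_sub_mul_le {a b c d : ℂ} (ha : ‖a‖ ≤ 1) (hd : ‖d‖ ≤ 1) :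
    ‖a * b - c * d‖ ≤ ‖a - c‖ + ‖b - d‖ := by
  have : a * b - c * d = a * (b - d) + (a - c) * d := by ring
  rw [this]
  refine (norm_add_le _ _).trans ?_
  rw [norm_mul, norm_mul]
  nlinarith [norm_nonneg (b - d), norm_nonneg (a - c)]

lemma tendsto_charFun_pairMixture {κ : ℕ → Kernel Ω ℝ} [∀ T, IsMarkovKernel (κ T)]
    {lam : Measure ℝ} [IsProbabilityMeasure lam]
    (h : ∀ s, Tendsto (fun T => ∫ ω, ‖charFun (κ T ω) s - charFun lam s‖ ∂P) atTop (𝓝 0))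
    (t : WithLp 2 (ℝ × ℝ)) :
    Tendsto (fun T => charFun (pairMixture P (κ T)) t) atTop
      (𝓝 (charFun lam t.fst * charFun lam t.snd)) := by
  have hint : ∀ T s, Integrable (fun ω => charFun (κ T ω) s) P := fun T s =>
    Integrable.of_bound (measurable_charFun_kernel (κ T) s).aestronglyMeasurable 1
      (ae_of_all _ fun ω => (norm_charFun_le_one _))
  have hint2 : ∀ T s, Integrable (fun ω => ‖charFun (κ T ω) s - charFun lam s‖) P := fun T s =>
    ((hint T s).sub (integrable_const _)).norm
  rw [tendsto_iff_norm_sub_tendsto_zero]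
  refine squeeze_zero (fun _ => norm_nonneg _) (fun T => ?_)
    (by simpa using (h t.fst).add (h t.snd))
  rw [charFun_pairMixture, ← integral_add (hint2 _ _) (hint2 _ _)]
  have e : charFun lam t.fst * charFun lam t.snd
      = ∫ _ω, charFun lam t.fst * charFun lam t.snd ∂P := by simp
  rw [e, ← integral_sub _ (integrable_const _)]
  · refine norm_integral_le_of_norm_le ((hint2 _ _).add (hint2 _ _)) (ae_of_all _ fun ω => ?_)
    exact norm_mul_sub_mul_le (norm_charFun_le_one _) (norm_charFun_le_one _)
  · refine Integrable.of_bound ((measurable_charFun_kernel (κ T) _).mul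
      (measurable_charFun_kernel (κ T) _)).aestronglyMeasurable 1 (ae_of_all _ fun ω => ?_)
    rw [norm_mul]
    exact mul_le_one₀ (norm_charFun_le_one _) (norm_nonneg _) (norm_charFun_le_one _)

/-- Lévy's continuity theorem for the deterministic measures `pairMixture P (κ T)`: averaging over
`ω` removes the randomness of the kernels, and the pair retains enough of it to control second
moments. -/
lemma tendsto_integral_pairMixture {κ : ℕ → Kernel Ω ℝ} [∀ T, IsMarkovKernel (κ T)]
    {lam : Measure ℝ} [IsProbabilityMeasure lam]
    (h : ∀ s, Tendsto (fun T => ∫ ω, ‖charFun (κ T ω) s - charFun lam s‖ ∂P) atTop (𝓝 0))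
    (g : ℝ × ℝ →ᵇ ℝ) :
    Tendsto (fun T => ∫ ω, ∫ x, g x ∂((κ T ω).prod (κ T ω)) ∂P) atTop
      (𝓝 (∫ x, g x ∂(lam.prod lam))) := by
  have hm : Measurable (WithLp.toLp 2 : ℝ × ℝ → WithLp 2 (ℝ × ℝ)) :=
    WithLp.measurable_toLp 2 (ℝ × ℝ)
  have : IsProbabilityMeasure ((lam.prod lam).map (WithLp.toLp 2 : ℝ × ℝ → WithLp 2 (ℝ × ℝ))) :=
    Measure.isProbabilityMeasure_map hm.aemeasurable
  let G : WithLp 2 (ℝ × ℝ) →ᵇ ℝ :=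
    g.compContinuous ⟨WithLp.ofLp, WithLp.prod_continuous_ofLp 2 ℝ ℝ⟩
  have key := (ProbabilityMeasure.tendsto_iff_forall_integral_tendsto.1
    (ProbabilityMeasure.tendsto_iff_tendsto_charFun
      (μ := fun T => (⟨pairMixture P (κ T), inferInstance⟩ : ProbabilityMeasure _))
      (μ₀ := ⟨(lam.prod lam).map (WithLp.toLp 2), inferInstance⟩) |>.2 fun t => by
        simpa [charFun_prod] using tendsto_charFun_pairMixture h t)) G
  simp only [ProbabilityMeasure.coe_mk] at key
  rw [integral_map hm.aemeasurable G.continuous.aestronglyMeasurable] at key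
  refine key.congr fun T => ?_
  exact integral_pairMixture (κ T) G.continuous.stronglyMeasurable (C := ‖G‖) G.norm_coe_le_norm

/-- Convergence in `L¹` of random characteristic functions implies convergence in `L²` of the
integrals of bounded continuous functions. -/
lemma tendsto_integral_sq_of_charFun {κ : ℕ → Kernel Ω ℝ} [∀ T, IsMarkovKernel (κ T)]
    {lam : Measure ℝ} [IsProbabilityMeasure lam]
    (h : ∀ s, Tendsto (fun T => ∫ ω, ‖charFun (κ T ω) s - charFun lam s‖ ∂P) atTop (𝓝 0))
    (f : ℝ →ᵇ ℝ) :
    Tendsto (fun T => ∫ ω, (∫ x, f x ∂(κ T ω) - ∫ x, f x ∂lam) ^ 2 ∂P) atTop (𝓝 0) := by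
  set c := ∫ x, f x ∂lam with hc
  let f1 : ℝ × ℝ →ᵇ ℝ := f.compContinuous ⟨Prod.fst, continuous_fst⟩
  let f2 : ℝ × ℝ →ᵇ ℝ := f.compContinuous ⟨Prod.snd, continuous_snd⟩
  let cc : ℝ × ℝ →ᵇ ℝ := BoundedContinuousFunction.const _ c
  -- The square of an integral is the integral of a product over two independent draws; centring at
  -- `c` makes the limit vanish.
  have key := tendsto_integral_pairMixture h ((f1 - cc) * (f2 - cc))
  have hprod : ∀ (ν : Measure ℝ) [IsProbabilityMeasure ν],
      ∫ x, ((f1 - cc) * (f2 - cc)) x ∂(ν.prod ν) = (∫ x, f x ∂ν - c) ^ 2 := by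
    intro ν _
    have : ∀ x : ℝ × ℝ, ((f1 - cc) * (f2 - cc)) x = (f x.1 - c) * (f x.2 - c) := fun x => rfl
    simp_rw [this]
    rw [integral_prod_mul (fun x => f x - c) (fun x => f x - c),
      integral_sub (f.integrable ν) (integrable_const _)]
    simp [sq]
  simp_rw [hprod] at key
  simpa [← hc] using key

/-- A criterion for conditional weak convergence through conditional characteristic functions. -/
lemma tendstoInMeasure_of_charFun {κ : ℕ → Kernel Ω ℝ} [∀ T, IsMarkovKernel (κ T)]
    {lam : Measure ℝ} [IsProbabilityMeasure lam]
    (h : ∀ s, Tendsto (fun T => ∫ ω, ‖charFun (κ T ω) s - charFun lam s‖ ∂P) atTop (𝓝 0))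
    (f : ℝ →ᵇ ℝ) :
    TendstoInMeasure P (fun T ω => ∫ x, f x ∂(κ T ω)) atTop (fun _ => ∫ x, f x ∂lam) := by
  refine tendstoInMeasure_of_tendsto_eLpNorm (p := 2) (by norm_num)
    (fun T => (measurable_integral_kernel (κ T) f).aestronglyMeasurable)
    aestronglyMeasurable_const ?_
  have hb : ∀ T, MemLp ((fun ω => ∫ x, f x ∂(κ T ω)) - fun _ => ∫ x, f x ∂lam) 2 P := by
    intro T
    refine MemLp.of_bound ((measurable_integral_kernel (κ T) f).sub
      measurable_const).aestronglyMeasurable (‖f‖ + ‖f‖) (ae_of_all _ fun ω => ?_)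
    exact (norm_sub_le _ _).trans (add_le_add (f.norm_integral_le_norm _)
      (f.norm_integral_le_norm _))
  have e : ∀ T, eLpNorm ((fun ω => ∫ x, f x ∂(κ T ω)) - fun _ => ∫ x, f x ∂lam) 2 P
      = ENNReal.ofReal ((∫ ω, (∫ x, f x ∂(κ T ω) - ∫ x, f x ∂lam) ^ 2 ∂P) ^ (2 : ℝ)⁻¹) := by
    intro T
    rw [(hb T).eLpNorm_eq_integral_rpow_norm (by norm_num) (by norm_num)]
    simp
  simp_rw [e]
  have := ((tendsto_integral_sq_of_charFun h f).rpow_const (p := (2 : ℝ)⁻¹) (by norm_num))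
  simpa using ENNReal.tendsto_ofReal this

end PairMixture

/-! ### Conditional characteristic functions under a joint density. -/

/-- The conditional characteristic function of `G (X, U)` given `X`, when the law of `(X, U)` has
density `D` with respect to a product measure. -/
lemma charFun_condDistrib_of_hasLaw_withDensity {Ω A V : Type*} [MeasurableSpace Ω]
    [MeasurableSpace A] [MeasurableSpace V] {P : Measure Ω} [IsProbabilityMeasure P]
    {ρ : Measure A} [IsProbabilityMeasure ρ] {m : Measure V} [IsProbabilityMeasure m]
    {D : A × V → ℝ} (hD : Measurable D) (hD0 : ∀ z, 0 ≤ D z)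
    {X : Ω → A} {U : Ω → V} (hX : HasLaw X ρ P)
    (hXU : HasLaw (fun ω => (X ω, U ω))
      ((ρ.prod m).withDensity fun z => ENNReal.ofReal (D z)) P)
    {G : A × V → ℝ} (hG : Measurable G) (s : ℝ) :
    ∀ᵐ a ∂ρ, charFun (condDistrib (fun ω => G (X ω, U ω)) X P a) s
      = ∫ v, (D (a, v) : ℂ) * Complex.exp (s * G (a, v) * Complex.I) ∂m := by
  set κ := condDistrib (fun ω => G (X ω, U ω)) X P with hκ
  have hM : AEMeasurable (fun ω => G (X ω, U ω)) P := hG.comp_aemeasurable hXU.aemeasurable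
  have hcomp : ρ ⊗ₘ κ = P.map fun ω => (X ω, G (X ω, U ω)) := by
    rw [← hX.map_eq, compProd_map_condDistrib hM]
  have hDint : Integrable D (ρ.prod m) := by
    have hp : IsProbabilityMeasure ((ρ.prod m).withDensity fun z => ENNReal.ofReal (D z)) :=
      hXU.isProbabilityMeasure_iff.1 inferInstance
    refine ⟨hD.aestronglyMeasurable, ?_⟩
    rw [hasFiniteIntegral_iff_ofReal (ae_of_all _ hD0)]
    have h1 := hp.measure_univ
    rw [withDensity_apply _ MeasurableSet.univ, Measure.restrict_univ] at h1
    rw [h1]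
    exact ENNReal.one_lt_top
  set e : A × V → ℂ := fun z => Complex.exp (s * G z * Complex.I) with he
  have hem : Measurable e := by fun_prop
  have hnorm : ∀ z, ‖e z‖ = 1 := fun z => by
    rw [he]
    simp only
    rw [← Complex.ofReal_mul, Complex.norm_exp_ofReal_mul_I]
  have hDe : Integrable (fun z => (D z : ℂ) * e z) (ρ.prod m) := by
    refine hDint.mono (by fun_prop) (ae_of_all _ fun z => ?_)
    simp [hnorm]
  -- Over any `B`, both sides integrate to the expectation of `exp (i s G (X, U))` on the event `X ∈
  -- B`.
  refine Integrable.ae_eq_of_forall_setIntegral_eq (μ := ρ) _ _ ?_ ?_ ?_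
  · exact Integrable.of_bound (measurable_charFun_kernel κ s).aestronglyMeasurable 1
      (ae_of_all _ fun a => norm_charFun_le_one _)
  · exact hDe.integral_prod_left
  · intro B hB _
    set g : A × ℝ → ℂ := fun z => Complex.exp (inner ℝ z.2 s * Complex.I) with hg
    have hgm : Continuous fun x : ℝ => Complex.exp (inner ℝ x s * Complex.I) := by fun_prop
    have hgm' : Measurable g := hgm.measurable.comp measurable_snd
    have h1 : ∫ a in B, charFun (κ a) s ∂ρ = ∫ z in B ×ˢ Set.univ, g z ∂(ρ ⊗ₘ κ) := by
      rw [Measure.setIntegral_compProd hB MeasurableSet.univ]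
      · simp only [Measure.restrict_univ]
        rfl
      · refine (Integrable.of_bound hgm'.aestronglyMeasurable 1
          (ae_of_all _ fun z => ?_)).integrableOn
        rw [hg, Complex.norm_exp_ofReal_mul_I]
    have h2 : ∫ a in B, ∫ v, (D (a, v) : ℂ) * e (a, v) ∂m ∂ρ
        = ∫ z in B ×ˢ Set.univ, (D z : ℂ) * e z ∂(ρ.prod m) := by
      rw [setIntegral_prod _ hDe.integrableOn]
      simp
    have hBm : MeasurableSet (B ×ˢ (Set.univ : Set V)) := hB.prod MeasurableSet.univ
    have hBm' : MeasurableSet (B ×ˢ (Set.univ : Set ℝ)) := hB.prod MeasurableSet.univ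
    have h3 : ∫ z in B ×ˢ Set.univ, (D z : ℂ) * e z ∂(ρ.prod m)
        = ∫ z in B ×ˢ Set.univ, e z ∂((ρ.prod m).withDensity fun z => ENNReal.ofReal (D z)) := by
      rw [restrict_withDensity hBm, integral_withDensity_eq_integral_toReal_smul hD.ennreal_ofReal
        (ae_of_all _ fun z => ENNReal.ofReal_lt_top)]
      refine integral_congr_ae (ae_of_all _ fun z => ?_)
      simp [ENNReal.toReal_ofReal (hD0 z)]
    rw [h1, h2, h3, hcomp, ← integral_indicator hBm', ← integral_indicator hBm, ← hXU.map_eq,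
      integral_map hXU.aemeasurable (hem.indicator hBm).aestronglyMeasurable,
      integral_map (hX.aemeasurable.prodMk hM) (hgm'.indicator hBm').aestronglyMeasurable]
    refine integral_congr_ae (ae_of_all _ fun ω => ?_)
    by_cases hω : X ω ∈ B
    · simp [hω, Set.indicator, hg, he]
    · simp [hω, Set.indicator]

/-! ### Moments of sums of independent centred variables. -/

section MomentInequalities

variable {V : Type*} [MeasurableSpace V] {ν : Measure V} [IsProbabilityMeasure ν] {X : V → ℝ}

lemma integrable_pow_of_integrable_pow_six (hX : AEStronglyMeasurable X ν)
    (h6 : Integrable (fun v => X v ^ 6) ν) {r : ℕ} (hr : r ≤ 6) :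
    Integrable (fun v => X v ^ r) ν := by
  refine Integrable.mono' ((integrable_const (1 : ℝ)).add h6) (hX.pow r) (ae_of_all _ fun v => ?_)
  simp only [Pi.add_apply, Real.norm_eq_abs, abs_pow]
  have h6' : X v ^ 6 = |X v| ^ 6 := (Even.pow_abs (by decide) _).symm
  rw [h6']
  rcases le_total |X v| 1 with h | h
  · have := pow_le_one₀ (n := r) (abs_nonneg (X v)) h
    have := pow_nonneg (abs_nonneg (X v)) 6
    linarith
  · have := pow_le_pow_right₀ h hr
    linarith

/-- Integrate `(X ^ 2 - c) ^ 2 ≥ 0`, with `c` the mean of `X ^ 2`. -/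
lemma sq_integral_sq_le (hX : AEStronglyMeasurable X ν) (h6 : Integrable (fun v => X v ^ 6) ν) :
    (∫ v, X v ^ 2 ∂ν) ^ 2 ≤ ∫ v, X v ^ 4 ∂ν := by
  set c := ∫ v, X v ^ 2 ∂ν
  have i2 := integrable_pow_of_integrable_pow_six hX h6 (r := 2) (by norm_num)
  have i4 := integrable_pow_of_integrable_pow_six hX h6 (r := 4) (by norm_num)
  have h := integral_mono (i2.const_mul (2 * c)) (i4.add (integrable_const (c ^ 2)))
    (fun v => by simp only [Pi.add_apply]; nlinarith [sq_nonneg (X v ^ 2 - c)])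
  rw [integral_const_mul, integral_add' i4 (integrable_const _)] at h
  simp only [integral_const, probReal_univ, smul_eq_mul] at h
  change 2 * c * c ≤ _ at h
  nlinarith

lemma sq_integral_cube_le (hX : AEStronglyMeasurable X ν) (h6 : Integrable (fun v => X v ^ 6) ν) :
    (∫ v, X v ^ 3 ∂ν) ^ 2 ≤ ∫ v, X v ^ 6 ∂ν := by
  set c := ∫ v, X v ^ 3 ∂ν
  have i3 := integrable_pow_of_integrable_pow_six hX h6 (r := 3) (by norm_num)
  have h := integral_mono (i3.const_mul (2 * c)) (h6.add (integrable_const (c ^ 2)))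
    (fun v => by simp only [Pi.add_apply]; nlinarith [sq_nonneg (X v ^ 3 - c)])
  rw [integral_const_mul, integral_add' h6 (integrable_const _)] at h
  simp only [integral_const, probReal_univ, smul_eq_mul] at h
  change 2 * c * c ≤ _ at h
  nlinarith

/-- Young's inequality for `X v ^ 2` and `X w ^ 2` at two independent points, integrated first in
`v`, then in `w`. -/
lemma integral_sq_mul_integral_pow_four_le (hX : AEStronglyMeasurable X ν)
    (h6 : Integrable (fun v => X v ^ 6) ν) :
    (∫ v, X v ^ 2 ∂ν) * ∫ v, X v ^ 4 ∂ν ≤ ∫ v, X v ^ 6 ∂ν := by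
  have i2 := integrable_pow_of_integrable_pow_six hX h6 (r := 2) (by norm_num)
  have i4 := integrable_pow_of_integrable_pow_six hX h6 (r := 4) (by norm_num)
  set c := ∫ v, X v ^ 2 ∂ν
  set d := ∫ v, X v ^ 6 ∂ν
  have young : ∀ p q : ℝ, 0 ≤ p → 0 ≤ q → 3 * (p * q ^ 2) ≤ p ^ 3 + 2 * q ^ 3 := fun p q hp hq => by
    nlinarith [mul_nonneg (add_nonneg hp (mul_nonneg zero_le_two hq)) (sq_nonneg (p - q))]
  have h1 : ∀ w, 3 * (c * X w ^ 4) ≤ d + 2 * X w ^ 6 := by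
    intro w
    have h := integral_mono (i2.const_mul (3 * X w ^ 4))
      (h6.add (integrable_const (2 * X w ^ 6))) (fun v => by
        simp only [Pi.add_apply]
        have := young (X v ^ 2) (X w ^ 2) (sq_nonneg _) (sq_nonneg _)
        linarith)
    rw [integral_const_mul, integral_add' h6 (integrable_const _)] at h
    simp only [integral_const, probReal_univ, smul_eq_mul] at h
    change 3 * X w ^ 4 * c ≤ d + _ at h
    linarith
  have h := integral_mono (i4.const_mul (3 * c)) ((integrable_const d).add (h6.const_mul 2))
    (fun w => by simp only [Pi.add_apply]; linarith [h1 w])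
  rw [integral_const_mul, integral_add' (integrable_const _) (h6.const_mul 2),
    integral_const_mul] at h
  simp only [integral_const, probReal_univ, smul_eq_mul] at h
  change _ ≤ 1 * d + 2 * d at h
  linarith

end MomentInequalities

section SumMoments

variable {Ω ι : Type*} [MeasurableSpace Ω] {P : Measure Ω} [IsProbabilityMeasure P]

/-- Moment identities and bounds satisfied by a sum of `n` independent centred variables with common
moments `m2`, `m3`, `m4` and `m6`. -/
structure SumMomentBounds (P : Measure Ω) (S : Ω → ℝ) (n m2 m3 m4 m6 : ℝ) : Prop where
  int6 : Integrable (fun ω => S ω ^ 6) P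
  mom1 : ∫ ω, S ω ∂P = 0
  mom2 : ∫ ω, S ω ^ 2 ∂P = n * m2
  mom3 : ∫ ω, S ω ^ 3 ∂P = n * m3
  mom4 : ∫ ω, S ω ^ 4 ∂P ≤ 3 * n ^ 2 * m4
  mom6 : ∫ ω, S ω ^ 6 ∂P ≤ 15 * n ^ 3 * m6

lemma SumMomentBounds.add {S X : Ω → ℝ} {n m2 m3 m4 m6 : ℝ} (hS : Measurable S)
    (hX : Measurable X) (hind : S ⟂ᵢ[P] X) (hn : 0 ≤ n) (h : SumMomentBounds P S n m2 m3 m4 m6)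
    (hX6 : Integrable (fun ω => X ω ^ 6) P) (h1 : ∫ ω, X ω ∂P = 0)
    (h2 : ∫ ω, X ω ^ 2 ∂P = m2) (h3 : ∫ ω, X ω ^ 3 ∂P = m3) (h4 : ∫ ω, X ω ^ 4 ∂P = m4)
    (h6 : ∫ ω, X ω ^ 6 ∂P = m6) :
    SumMomentBounds P (fun ω => S ω + X ω) (n + 1) m2 m3 m4 m6 := by
  have hm : ∀ a b : ℕ, ∫ ω, S ω ^ a * X ω ^ b ∂P = (∫ ω, S ω ^ a ∂P) * ∫ ω, X ω ^ b ∂P :=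
    fun a b => hind.integral_fun_comp_mul_comp (f := fun x => x ^ a) (g := fun x => x ^ b)
      hS.aemeasurable hX.aemeasurable (by fun_prop) (by fun_prop)
  have iS : ∀ a ≤ 6, Integrable (fun ω => S ω ^ a) P := fun a ha =>
    integrable_pow_of_integrable_pow_six hS.aestronglyMeasurable h.int6 ha
  have iX : ∀ a ≤ 6, Integrable (fun ω => X ω ^ a) P := fun a ha =>
    integrable_pow_of_integrable_pow_six hX.aestronglyMeasurable hX6 ha
  have im : ∀ a ≤ 6, ∀ b ≤ 6, Integrable (fun ω => S ω ^ a * X ω ^ b) P := fun a ha b hb =>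
    (hind.comp (φ := fun x => x ^ a) (ψ := fun x => x ^ b) (by fun_prop)
      (by fun_prop)).integrable_mul (iS a ha) (iX b hb)
  have expand : ∀ r ≤ 6, ∀ ω, (S ω + X ω) ^ r
      = ∑ k ∈ Finset.range (r + 1), (r.choose k : ℝ) * (S ω ^ k * X ω ^ (r - k)) := by
    intro r _ ω
    rw [add_pow]
    exact Finset.sum_congr rfl fun k _ => by ring
  have it : ∀ r ≤ 6, ∀ k ∈ Finset.range (r + 1),
      Integrable (fun ω => (r.choose k : ℝ) * (S ω ^ k * X ω ^ (r - k))) P := fun r hr k hk =>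
    (im k (by have := Finset.mem_range.1 hk; omega) (r - k) (by omega)).const_mul _
  have mom : ∀ r ≤ 6, ∫ ω, (S ω + X ω) ^ r ∂P
      = ∑ k ∈ Finset.range (r + 1),
        (r.choose k : ℝ) * ((∫ ω, S ω ^ k ∂P) * ∫ ω, X ω ^ (r - k) ∂P) := by
    intro r hr
    simp_rw [expand r hr]
    rw [integral_finsetSum _ (it r hr)]
    exact Finset.sum_congr rfl fun k _ => by rw [integral_const_mul, hm]
  have hS1 : ∫ ω, S ω ^ 1 ∂P = 0 := by simpa using h.mom1
  have hX1 : ∫ ω, X ω ^ 1 ∂P = 0 := by simpa using h1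
  have hS0 : ∫ ω, S ω ^ 0 ∂P = 1 := by simp
  have hX0 : ∫ ω, X ω ^ 0 ∂P = 1 := by simp
  have c1 := sq_integral_sq_le hX.aestronglyMeasurable hX6
  have c2 := sq_integral_cube_le hX.aestronglyMeasurable hX6
  have c3 := integral_sq_mul_integral_pow_four_le hX.aestronglyMeasurable hX6
  rw [h2, h4] at c1
  rw [h3, h6] at c2
  rw [h2, h4, h6] at c3
  have p2 : 0 ≤ m2 := h2 ▸ integral_nonneg fun ω => by positivity
  have p4 : 0 ≤ m4 := h4 ▸ integral_nonneg fun ω => by positivity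
  have p6 : 0 ≤ m6 := h6 ▸ integral_nonneg fun ω => by positivity
  refine ⟨?_, ?_, ?_, ?_, ?_, ?_⟩
  · simp_rw [expand 6 le_rfl]
    exact integrable_finsetSum _ (it 6 le_rfl)
  · have := mom 1 (by norm_num)
    simpa [Finset.sum_range_succ, h1, h.mom1] using this
  · rw [mom 2 (by norm_num)]
    simp only [Finset.sum_range_succ, Finset.sum_range_zero, Nat.sub_self, Nat.reduceSub, hS0, hS1,
      hX0, hX1, h.mom2, h2, Nat.choose]
    norm_num
    ring
  · rw [mom 3 (by norm_num)]
    simp only [Finset.sum_range_succ, Finset.sum_range_zero, Nat.sub_self, Nat.reduceSub, hS0, hS1,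
      hX0, hX1, h.mom2, h.mom3, h2, h3, Nat.choose]
    norm_num
    ring
  · rw [mom 4 (by norm_num)]
    simp only [Finset.sum_range_succ, Finset.sum_range_zero, Nat.sub_self, Nat.reduceSub, hS0, hS1,
      hX0, hX1, h.mom2, h.mom3, h2, h3, h4, Nat.choose]
    norm_num
    -- The induction closes because `m2 ^ 2 ≤ m4` and `3 n ^ 2 + 6 n + 1 ≤ 3 (n + 1) ^ 2`.
    nlinarith [h.mom4, mul_le_mul_of_nonneg_left c1 hn]
  · rw [mom 6 (by norm_num)]
    simp only [Finset.sum_range_succ, Finset.sum_range_zero, Nat.sub_self, Nat.reduceSub, hS0, hS1,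
      hX0, hX1, h.mom2, h.mom3, h2, h3, h4, h6, Nat.choose]
    norm_num
    -- The terms of the expansion add up to at most `(15 n ^ 3 + 45 n ^ 2 + 35 n + 1) * m6`, which
    -- is below `15 (n + 1) ^ 3 * m6`.
    have e1 := mul_le_mul_of_nonneg_right h.mom4 p2
    have e2 := mul_le_mul_of_nonneg_left c3 (sq_nonneg n)
    have e3 := mul_le_mul_of_nonneg_left c2 hn
    have e4 := mul_le_mul_of_nonneg_left c3 hn
    have e5 := mul_nonneg hn p6
    nlinarith [h.mom6]

lemma sumMomentBounds_sum {X : ι → Ω → ℝ} {m2 m3 m4 m6 : ℝ} (hX : ∀ i, Measurable (X i))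
    (hind : iIndepFun X P) (hX6 : ∀ i, Integrable (fun ω => X i ω ^ 6) P)
    (h1 : ∀ i, ∫ ω, X i ω ∂P = 0) (h2 : ∀ i, ∫ ω, X i ω ^ 2 ∂P = m2)
    (h3 : ∀ i, ∫ ω, X i ω ^ 3 ∂P = m3) (h4 : ∀ i, ∫ ω, X i ω ^ 4 ∂P = m4)
    (h6 : ∀ i, ∫ ω, X i ω ^ 6 ∂P = m6) (s : Finset ι) :
    SumMomentBounds P (fun ω => ∑ i ∈ s, X i ω) s.card m2 m3 m4 m6 := by
  classical
  induction s using Finset.induction_on with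
  | empty => constructor <;> simp
  | insert i s hi ih =>
    have hS : (fun ω => ∑ j ∈ s, X j ω) = ∑ j ∈ s, X j := by ext ω; simp
    have := ih.add (Finset.measurable_sum s fun j _ => hX j) (hX i)
      (by rw [hS]; exact hind.indepFun_finsetSum_of_notMem hX hi) (Nat.cast_nonneg _) (hX6 i)
      (h1 i) (h2 i) (h3 i) (h4 i) (h6 i)
    rw [Finset.card_insert_of_notMem hi]
    push_cast
    convert this using 2 with ω
    rw [Finset.sum_insert hi, add_comm]

/-- Moments of a sum of i.i.d. centred variables on a product space. -/
lemma sumMomentBounds_pi [Fintype ι] {V : Type*} [MeasurableSpace V] {ν : Measure V}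
    [IsProbabilityMeasure ν] {X : V → ℝ} (hX : Measurable X)
    (h6 : Integrable (fun v => X v ^ 6) ν) (h1 : ∫ v, X v ∂ν = 0) :
    SumMomentBounds (Measure.pi fun _ : ι => ν) (fun u => ∑ i, X (u i)) (Fintype.card ι)
      (∫ v, X v ^ 2 ∂ν) (∫ v, X v ^ 3 ∂ν) (∫ v, X v ^ 4 ∂ν) (∫ v, X v ^ 6 ∂ν) := by
  have mp := fun i : ι => measurePreserving_eval (fun _ : ι => ν) i
  have hi : ∀ (i : ι) (r : ℕ), ∫ u, X (u i) ^ r ∂(Measure.pi fun _ : ι => ν)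
      = ∫ v, X v ^ r ∂ν := fun i r => by
    have h := integral_map (μ := Measure.pi fun _ : ι => ν) (mp i).measurable.aemeasurable
      (f := fun v => X v ^ r) (by fun_prop)
    rw [(mp i).map_eq] at h
    exact h.symm
  refine sumMomentBounds_sum (X := fun i (u : ι → V) => X (u i)) (fun i => by fun_prop)
    (iIndepFun_pi fun _ => hX.aemeasurable) (fun i => ?_) (fun i => ?_)
    (fun i => hi i 2) (fun i => hi i 3) (fun i => hi i 4) (fun i => hi i 6) Finset.univ
  · exact (mp i).integrable_comp_of_integrable h6
  · simpa [h1] using hi i 1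

end SumMoments

/-! ### Taylor expansion of `(1 + e) ^ (j + i b)`. -/

noncomputable section

/-- The function `x ↦ x ^ j * exp (i b log x)`, which is `x ^ (j + i b)` for positive `x`. -/
def tiltedPhase (j : ℕ) (b x : ℝ) : ℂ := (x : ℂ) ^ j * Complex.exp (b * Real.log x * Complex.I)

/-- The Taylor polynomial of degree three of `e ↦ (1 + e) ^ z`. -/
def binomTaylor (z : ℂ) (e : ℝ) : ℂ :=
  1 + z * e + z * (z - 1) / 2 * (e : ℂ) ^ 2 + z * (z - 1) * (z - 2) / 6 * (e : ℂ) ^ 3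

lemma measurable_tiltedPhase (j : ℕ) (b : ℝ) : Measurable (tiltedPhase j b) := by
  unfold tiltedPhase
  fun_prop

lemma norm_tiltedPhase (j : ℕ) (b : ℝ) {x : ℝ} (hx : 0 ≤ x) : ‖tiltedPhase j b x‖ = x ^ j := by
  rw [tiltedPhase, norm_mul, ← Complex.ofReal_mul, Complex.norm_exp_ofReal_mul_I, mul_one, norm_pow,
    Complex.norm_real, Real.norm_of_nonneg hx]

lemma tiltedPhase_of_pos (j : ℕ) (b : ℝ) {x : ℝ} (hx : 0 < x) :
    tiltedPhase j b x = Complex.exp ((j + b * Complex.I) * Real.log x) := by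
  rw [tiltedPhase, add_mul, Complex.exp_add, Complex.exp_nat_mul, ← Complex.ofReal_exp,
    Real.exp_log hx]
  congr 2
  ring

/-- The mean value inequality on `[-|x|, |x|]`: each use raises the order of a Taylor remainder by
one. -/
lemma norm_le_of_hasDerivAt_of_norm_le_pow {f f' : ℝ → ℂ} {K : ℝ} {n : ℕ} (hK : 0 ≤ K)
    (h0 : f 0 = 0) (hf : ∀ x, |x| ≤ 1 / 2 → HasDerivAt f (f' x) x)
    (hf' : ∀ x, |x| ≤ 1 / 2 → ‖f' x‖ ≤ K * |x| ^ n) {x : ℝ} (hx : |x| ≤ 1 / 2) :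
    ‖f x‖ ≤ K * |x| ^ (n + 1) := by
  have mem : ∀ y ∈ Set.Icc (-|x|) |x|, |y| ≤ |x| := fun y hy => abs_le.2 hy
  have := Convex.norm_image_sub_le_of_norm_hasDerivWithin_le (f := f) (f' := f')
    (s := Set.Icc (-|x|) |x|) (x := 0) (y := x) (C := K * |x| ^ n)
    (fun y hy => (hf y ((mem y hy).trans hx)).hasDerivWithinAt)
    (fun y hy => (hf' y ((mem y hy).trans hx)).trans
      (mul_le_mul_of_nonneg_left (pow_le_pow_left₀ (abs_nonneg _) (mem y hy) n) hK))
    (convex_Icc _ _) (by simp) ⟨neg_abs_le x, le_abs_self x⟩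
  rw [h0, sub_zero, sub_zero, Real.norm_eq_abs] at this
  rwa [pow_succ, ← mul_assoc]

lemma hasDerivAt_exp_mul_log_one_add (z : ℂ) {x : ℝ} (hx : 0 < 1 + x) :
    HasDerivAt (fun e : ℝ => Complex.exp (z * Real.log (1 + e)))
      (z * Complex.exp ((z - 1) * Real.log (1 + x))) x := by
  have h1 : HasDerivAt (fun e : ℝ => Real.log (1 + e)) (1 / (1 + x)) x :=
    ((hasDerivAt_id x).const_add 1).log hx.ne'
  have h2 := ((h1.ofReal_comp).const_mul z).cexp
  convert h2 using 1
  rw [sub_mul, Complex.exp_sub, one_mul, ← Complex.ofReal_exp, Real.exp_log hx]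
  push_cast
  field_simp

/-- Taylor expansion of a complex power around one, with a remainder of order four. -/
lemma norm_exp_mul_log_sub_binomTaylor_le (z : ℂ) (hz : -4 ≤ (z - 4).re) (hz' : (z - 4).re ≤ 0)
    {e : ℝ} (he : |e| ≤ 1 / 2) :
    ‖Complex.exp (z * Real.log (1 + e)) - binomTaylor z e‖
      ≤ 16 * ‖z - 3‖ * ‖z - 2‖ * ‖z - 1‖ * ‖z‖ * |e| ^ 4 := by
  have pos : ∀ x : ℝ, |x| ≤ 1 / 2 → 0 < 1 + x := fun x hx => by
    have := (abs_le.1 hx).1; linarith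
  have d : ∀ (w : ℂ) (x : ℝ), |x| ≤ 1 / 2 →
      HasDerivAt (fun e : ℝ => Complex.exp (w * Real.log (1 + e)))
        (w * Complex.exp ((w - 1) * Real.log (1 + x))) x := fun w x hx =>
    hasDerivAt_exp_mul_log_one_add w (pos x hx)
  have dx : ∀ x : ℝ, HasDerivAt (fun e : ℝ => (e : ℂ)) 1 x := fun x =>
    (hasDerivAt_id x).ofReal_comp
  -- Here `1 + x ≥ 1 / 2` and the real part of `z - 4` lies in `[-4, 0]`, so the modulus is at most
  -- `2 ^ 4`.
  have b4 : ∀ x : ℝ, |x| ≤ 1 / 2 → ‖Complex.exp ((z - 4) * Real.log (1 + x))‖ ≤ 16 := by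
    intro x hx
    have hp := pos x hx
    rw [Complex.norm_exp, Complex.re_mul_ofReal]
    have hl : -Real.log 2 ≤ Real.log (1 + x) := by
      rw [← Real.log_inv]
      refine Real.log_le_log (by norm_num) ?_
      have := (abs_le.1 hx).1; linarith
    have : (16 : ℝ) = Real.exp (4 * Real.log 2) := by
      rw [show (4 : ℝ) * Real.log 2 = Real.log (2 ^ 4) by rw [Real.log_pow]; norm_num,
        Real.exp_log (by norm_num)]
      norm_num
    rw [this]
    refine Real.exp_le_exp.2 ?_
    have l2 : 0 ≤ Real.log 2 := Real.log_nonneg (by norm_num)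
    nlinarith
  -- The derivative of the order `n` remainder for exponent `w` is `w` times the order `n - 1`
  -- remainder for `w - 1`. Starting from the exponent `z - 4`, four integrations reach `z`.
  have r0 : ∀ x : ℝ, |x| ≤ 1 / 2 →
      ‖Complex.exp ((z - 3) * Real.log (1 + x)) - 1‖ ≤ 16 * ‖z - 3‖ * |x| ^ 1 := by
    intro x hx
    refine norm_le_of_hasDerivAt_of_norm_le_pow (n := 0)
      (f := fun x => Complex.exp ((z - 3) * Real.log (1 + x)) - 1)
      (f' := fun x => (z - 3) * Complex.exp ((z - 4) * Real.log (1 + x)))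
      (by positivity) (by simp) (fun y hy => ?_) (fun y hy => ?_) hx
    · refine ((d (z - 3) y hy).sub_const 1).congr_deriv ?_
      rw [show z - 3 - 1 = z - 4 by ring]
    · rw [norm_mul, pow_zero, mul_one, mul_comm]
      exact mul_le_mul_of_nonneg_right (b4 y hy) (norm_nonneg _)
  have r1 : ∀ x : ℝ, |x| ≤ 1 / 2 →
      ‖Complex.exp ((z - 2) * Real.log (1 + x)) - 1 - (z - 2) * x‖
        ≤ 16 * ‖z - 3‖ * ‖z - 2‖ * |x| ^ 2 := by
    intro x hx
    refine norm_le_of_hasDerivAt_of_norm_le_pow (n := 1)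
      (f := fun x => Complex.exp ((z - 2) * Real.log (1 + x)) - 1 - (z - 2) * x)
      (f' := fun x => (z - 2) * (Complex.exp ((z - 3) * Real.log (1 + x)) - 1))
      (by positivity) (by simp) (fun y hy => ?_) (fun y hy => ?_) hx
    · refine (((d (z - 2) y hy).sub_const 1).sub ((dx y).const_mul (z - 2))).congr_deriv ?_
      rw [show z - 2 - 1 = z - 3 by ring]
      ring
    · rw [norm_mul]
      have := mul_le_mul_of_nonneg_left (r0 y hy) (norm_nonneg (z - 2))
      linarith
  have r2 : ∀ x : ℝ, |x| ≤ 1 / 2 →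
      ‖Complex.exp ((z - 1) * Real.log (1 + x)) - 1 - (z - 1) * x
          - (z - 1) * (z - 2) / 2 * (x : ℂ) ^ 2‖
        ≤ 16 * ‖z - 3‖ * ‖z - 2‖ * ‖z - 1‖ * |x| ^ 3 := by
    intro x hx
    refine norm_le_of_hasDerivAt_of_norm_le_pow (n := 2)
      (f := fun x => Complex.exp ((z - 1) * Real.log (1 + x)) - 1 - (z - 1) * x
        - (z - 1) * (z - 2) / 2 * (x : ℂ) ^ 2)
      (f' := fun x => (z - 1) * (Complex.exp ((z - 2) * Real.log (1 + x)) - 1 - (z - 2) * x))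
      (by positivity) (by simp) (fun y hy => ?_) (fun y hy => ?_) hx
    · refine ((((d (z - 1) y hy).sub_const 1).sub ((dx y).const_mul (z - 1))).sub
        (((dx y).pow 2).const_mul ((z - 1) * (z - 2) / 2))).congr_deriv ?_
      rw [show z - 1 - 1 = z - 2 by ring]
      push_cast
      ring
    · rw [norm_mul]
      have := mul_le_mul_of_nonneg_left (r1 y hy) (norm_nonneg (z - 1))
      linarith
  refine (le_of_eq ?_).trans (norm_le_of_hasDerivAt_of_norm_le_pow (n := 3)
      (f := fun x => Complex.exp (z * Real.log (1 + x)) - 1 - z * x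
        - z * (z - 1) / 2 * (x : ℂ) ^ 2 - z * (z - 1) * (z - 2) / 6 * (x : ℂ) ^ 3)
      (f' := fun x => z * (Complex.exp ((z - 1) * Real.log (1 + x)) - 1 - (z - 1) * x
          - (z - 1) * (z - 2) / 2 * (x : ℂ) ^ 2))
      (by positivity) (by simp) (fun y hy => ?_) (fun y hy => ?_) he)
  · rw [binomTaylor]
    congr 1
    ring
  · refine (((((d z y hy).sub_const 1).sub ((dx y).const_mul z)).sub
        (((dx y).pow 2).const_mul (z * (z - 1) / 2))).sub
        (((dx y).pow 3).const_mul (z * (z - 1) * (z - 2) / 6))).congr_deriv ?_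
    push_cast
    ring
  · rw [norm_mul]
    have := mul_le_mul_of_nonneg_left (r2 y hy) (norm_nonneg z)
    linarith

lemma norm_natCast_add_mul_I_sub_le {j : ℕ} (hj : j ≤ 1) (b : ℝ) {c : ℝ} (hc : 1 ≤ c) :
    ‖(j + b * Complex.I : ℂ) - c‖ ≤ c + |b| := by
  have h : (j + b * Complex.I : ℂ) - c = ((j - c : ℝ) : ℂ) + b * Complex.I := by push_cast; ring
  rw [h]
  refine (norm_add_le _ _).trans ?_
  have h1 : |(j : ℝ) - c| ≤ c := by
    have : (j : ℝ) ≤ 1 := by exact_mod_cast hj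
    have : (0 : ℝ) ≤ j := Nat.cast_nonneg j
    rw [abs_le]; constructor <;> linarith
  rw [Complex.norm_real, norm_mul, Complex.norm_I, mul_one, Complex.norm_real]
  simpa using h1

/-- One of the two factors is exactly `i b`. The resulting factor `|b|` is what brings the threshold
down to `α > 1/3`: without it the errors would be of order `T / N ^ 2`. -/
lemma norm_natCast_add_mul_I_mul_sub_one_le {j : ℕ} (hj : j ≤ 1) (b : ℝ) :
    ‖(j + b * Complex.I : ℂ)‖ * ‖(j + b * Complex.I : ℂ) - 1‖ ≤ |b| * (1 + |b|) := by
  interval_cases j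
  · have := norm_natCast_add_mul_I_sub_le (j := 0) (by norm_num) b le_rfl
    simp only [Nat.cast_zero, zero_add, Complex.ofReal_one, norm_mul, Complex.norm_I, mul_one,
      Complex.norm_real, Real.norm_eq_abs] at this ⊢
    exact mul_le_mul_of_nonneg_left this (abs_nonneg b)
  · have h : ‖(1 + b * Complex.I : ℂ)‖ ≤ 1 + |b| := by
      refine (norm_add_le _ _).trans ?_
      simp
    simp only [Nat.cast_one, add_sub_cancel_left, norm_mul, Complex.norm_I, mul_one,
      Complex.norm_real, Real.norm_eq_abs] at h ⊢
    rw [mul_comm]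
    exact mul_le_mul_of_nonneg_left h (abs_nonneg b)

lemma norm_tiltedPhase_sub_binomTaylor_le {j : ℕ} (hj : j ≤ 1) {b s : ℝ} (hb : |b| ≤ s) {e : ℝ}
    (he : -1 ≤ e) :
    ‖tiltedPhase j b (1 + e) - binomTaylor (j + b * Complex.I) e‖
      ≤ 256 * (3 + s) ^ 3 * (|b| * e ^ 4 + e ^ 6) := by
  set z : ℂ := j + b * Complex.I with hz
  have hs : 0 ≤ s := (abs_nonneg b).trans hb
  have hj1 : (j : ℝ) ≤ 1 := by exact_mod_cast hj
  have hj0 : (0 : ℝ) ≤ j := Nat.cast_nonneg j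
  have n1 : ‖z - 1‖ ≤ 3 + s := by
    have := norm_natCast_add_mul_I_sub_le hj b (c := 1) le_rfl
    push_cast at this; linarith
  have n2 : ‖z - 2‖ ≤ 3 + s := by
    have := norm_natCast_add_mul_I_sub_le hj b (c := 2) (by norm_num)
    push_cast at this; linarith
  have n3 : ‖z - 3‖ ≤ 3 + s := by
    have := norm_natCast_add_mul_I_sub_le hj b (c := 3) (by norm_num)
    push_cast at this; linarith
  have n0 : ‖z‖ ≤ 3 + s := by
    rw [hz]
    refine (norm_add_le _ _).trans ?_
    rw [norm_mul, Complex.norm_I, mul_one, Complex.norm_real, Complex.norm_natCast,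
      Real.norm_eq_abs]
    linarith
  have n01 : ‖z‖ * ‖z - 1‖ ≤ |b| * (3 + s) :=
    (norm_natCast_add_mul_I_mul_sub_one_le hj b).trans
      (mul_le_mul_of_nonneg_left (by linarith) (abs_nonneg b))
  set q := 3 + s with hq
  have q1 : 1 ≤ q := by linarith
  have e4 : |e| ^ 4 = e ^ 4 := Even.pow_abs (by decide) _
  have e6 : |e| ^ 6 = e ^ 6 := Even.pow_abs (by decide) _
  -- For small `e` the Taylor remainder carries `|b| * e ^ 4`. For large `e` no factor `|b|` is
  -- available, but `2 |e| ≥ 1` turns every term of the crude bound into a multiple of `e ^ 6`,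
  -- whose mean is of order `N ^ (-3)`.
  rcases le_total |e| (1 / 2) with h | h
  · have hp : 0 < 1 + e := by have := (abs_le.1 h).1; linarith
    rw [tiltedPhase_of_pos j b hp]
    refine (norm_exp_mul_log_sub_binomTaylor_le z ?_ ?_ h).trans ?_
    · simp [hz]
    · simp [hz]; linarith
    · rw [e4]
      have h23 : ‖z - 3‖ * ‖z - 2‖ ≤ q * q :=
        mul_le_mul n3 n2 (norm_nonneg _) (by linarith)
      have h4 : ‖z - 3‖ * ‖z - 2‖ * (‖z‖ * ‖z - 1‖) ≤ q * q * (|b| * q) :=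
        mul_le_mul h23 n01 (by positivity) (by positivity)
      have h5 := mul_le_mul_of_nonneg_right h4 (show 0 ≤ e ^ 4 by positivity)
      have h6 : 0 ≤ q ^ 3 * (|b| * e ^ 4) := by positivity
      have h7 : 0 ≤ q ^ 3 * e ^ 6 := by positivity
      nlinarith
  · have t0 : ‖tiltedPhase j b (1 + e)‖ ≤ 1 + |e| := by
      rw [norm_tiltedPhase j b (by linarith)]
      interval_cases j
      · simp
      · simpa using le_abs_self e
    have t1 : ‖binomTaylor z e‖ ≤ 1 + q * |e| + q ^ 2 * |e| ^ 2 + q ^ 3 * |e| ^ 3 := by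
      rw [binomTaylor]
      refine (norm_add_le _ _).trans (add_le_add ((norm_add_le _ _).trans
        (add_le_add ((norm_add_le _ _).trans (add_le_add ?_ ?_)) ?_)) ?_)
      · simp
      · rw [norm_mul, Complex.norm_real]
        exact mul_le_mul_of_nonneg_right n0 (abs_nonneg _)
      · rw [norm_mul, norm_pow, Complex.norm_real, norm_div, norm_mul]
        refine mul_le_mul_of_nonneg_right ?_ (by positivity)
        have := mul_le_mul n0 n1 (norm_nonneg _) (by linarith)
        have h0 : 0 ≤ ‖z‖ * ‖z - 1‖ := by positivity
        simp only [Complex.norm_ofNat]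
        linarith
      · rw [norm_mul, norm_pow, Complex.norm_real, norm_div, norm_mul, norm_mul]
        refine mul_le_mul_of_nonneg_right ?_ (by positivity)
        have := mul_le_mul (mul_le_mul n0 n1 (norm_nonneg _) (by linarith)) n2 (norm_nonneg _)
          (by positivity)
        have h0 : 0 ≤ ‖z‖ * ‖z - 1‖ * ‖z - 2‖ := by positivity
        simp only [Complex.norm_ofNat]
        linarith
    refine (norm_sub_le _ _).trans ((add_le_add t0 t1).trans ?_)
    rw [← e6]
    set x := |e| with hx
    have x0 : 0 < x := by linarith
    have x1 : 1 ≤ 2 * x := by linarith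
    have m3 : x ^ 3 ≤ 8 * x ^ 6 := by
      have := mul_le_mul_of_nonneg_left (one_le_pow₀ x1 (n := 3)) (pow_nonneg x0.le 3)
      nlinarith
    have m2 : x ^ 2 ≤ 2 * x ^ 3 := by
      have := mul_le_mul_of_nonneg_left x1 (pow_nonneg x0.le 2)
      nlinarith
    have m1 : x ≤ 2 * x ^ 2 := by nlinarith
    have q2 : q ^ 2 ≤ q ^ 3 := pow_le_pow_right₀ q1 (by norm_num)
    have q3 : q ≤ q ^ 3 := le_self_pow₀ q1 (by norm_num)
    have q4 : 1 ≤ q ^ 3 := one_le_pow₀ q1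
    have k1 : q * x ≤ q ^ 3 * (32 * x ^ 6) := mul_le_mul q3 (by linarith) x0.le (by positivity)
    have k2 : q ^ 2 * x ^ 2 ≤ q ^ 3 * (16 * x ^ 6) :=
      mul_le_mul q2 (by linarith) (by positivity) (by positivity)
    have k3 : q ^ 3 * x ^ 3 ≤ q ^ 3 * (8 * x ^ 6) :=
      mul_le_mul_of_nonneg_left m3 (by positivity)
    have k4 : 64 * x ^ 6 ≤ q ^ 3 * (64 * x ^ 6) := by
      have : 0 ≤ 64 * x ^ 6 := by positivity
      nlinarith
    have k5 : 0 ≤ q ^ 3 * (|b| * e ^ 4) := by positivity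
    nlinarith


/-- In the left half-plane the exponential is bounded by one, so the quadratic bound holds for large
`w` too. -/
lemma norm_exp_sub_one_sub_le_of_re_nonpos {w : ℂ} (hw : w.re ≤ 0) :
    ‖Complex.exp w - 1 - w‖ ≤ 3 * ‖w‖ ^ 2 := by
  rcases le_total ‖w‖ 1 with h | h
  · have := Complex.norm_exp_sub_one_sub_id_le h
    nlinarith [sq_nonneg ‖w‖]
  · have h1 : ‖Complex.exp w‖ ≤ 1 := by
      rw [Complex.norm_exp]
      exact Real.exp_le_one_iff.2 hw
    have h2 : ‖Complex.exp w - 1 - w‖ ≤ 1 + 1 + ‖w‖ := by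
      refine (norm_sub_le _ _).trans (add_le_add ((norm_sub_le _ _).trans ?_) le_rfl)
      simpa using h1
    nlinarith

/-- Telescoping: replacing one factor at a time costs only that factor's difference inside the unit
disc. -/
lemma norm_prod_sub_prod_le {ι : Type*} (s : Finset ι) {a b : ι → ℂ} (ha : ∀ i ∈ s, ‖a i‖ ≤ 1)
    (hb : ∀ i ∈ s, ‖b i‖ ≤ 1) : ‖∏ i ∈ s, a i - ∏ i ∈ s, b i‖ ≤ ∑ i ∈ s, ‖a i - b i‖ := by
  classical
  induction s using Finset.induction_on with
  | empty => simp
  | insert i s hi ih =>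
    rw [Finset.prod_insert hi, Finset.prod_insert hi, Finset.sum_insert hi]
    refine (norm_mul_sub_mul_le (ha i (Finset.mem_insert_self i s)) ?_).trans
      (add_le_add le_rfl (ih (fun k hk => ha k (Finset.mem_insert_of_mem hk))
        fun k hk => hb k (Finset.mem_insert_of_mem hk)))
    rw [norm_prod]
    exact Finset.prod_le_one (fun _ _ => norm_nonneg _)
      fun k hk => hb k (Finset.mem_insert_of_mem hk)

/-! ### The characteristic exponent of a single observation. -/

/-- The second order coefficient of the characteristic exponent: `z (z - 1) / 2` for
`z = j + i b`. -/
def phaseCoeff (j : ℕ) (b : ℝ) : ℂ := (j + b * Complex.I) * ((j + b * Complex.I) - 1) / 2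

/-- The real part is the same in both regimes, while the imaginary part changes sign with `j`; this
is the source of the opposite drifts. -/
lemma phaseCoeff_eq {j : ℕ} (hj : j ≤ 1) (b : ℝ) :
    phaseCoeff j b = ((-(b ^ 2) / 2 : ℝ) : ℂ) + (((2 * j - 1) * b / 2 : ℝ) : ℂ) * Complex.I := by
  rw [phaseCoeff]
  interval_cases j
  · push_cast
    linear_combination ((b : ℂ) ^ 2 / 2) * Complex.I_sq
  · push_cast
    linear_combination ((b : ℂ) ^ 2 / 2) * Complex.I_sq

lemma phaseCoeff_re {j : ℕ} (hj : j ≤ 1) (b : ℝ) : (phaseCoeff j b).re = -(b ^ 2) / 2 := by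
  rw [phaseCoeff_eq hj, Complex.add_re, Complex.re_ofReal_mul]
  simp only [Complex.ofReal_re, Complex.I_re, mul_zero, add_zero]

/-- The average of `X` over the coordinates. -/
def avg {V : Type*} (X : V → ℝ) {N : ℕ} (u : Fin N → V) : ℝ := (N : ℝ)⁻¹ * ∑ i, X (u i)

lemma neg_one_le_avg {V : Type*} {X : V → ℝ} {N : ℕ} (hN : 0 < N) (hX : ∀ v, -1 ≤ X v) (u : Fin N → V) : -1 ≤ avg X u := by
  have hN' : (0 : ℝ) < N := by exact_mod_cast hN
  have h : ∑ _i : Fin N, (-1 : ℝ) ≤ ∑ i, X (u i) := Finset.sum_le_sum fun i _ => hX _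
  simp only [Finset.sum_const, Finset.card_univ, Fintype.card_fin, nsmul_eq_mul] at h
  rw [avg, inv_mul_eq_div, le_div_iff₀ hN']
  linarith

section Factor

variable {V : Type*} [MeasurableSpace V] {ν : Measure V} [IsProbabilityMeasure ν] {X : V → ℝ}
  {N : ℕ}

lemma measurable_avg (hX : Measurable X) : Measurable (avg X (N := N)) := by
  unfold avg
  fun_prop

/-- The moments of an average of `N` i.i.d. centred variables. -/
structure AvgMomentBounds (ν : Measure V) (X : V → ℝ) (N : ℕ) : Prop where
  int : ∀ r ≤ 6, Integrable (fun u : Fin N → V => avg X u ^ r) (Measure.pi fun _ => ν)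
  mom1 : ∫ u : Fin N → V, avg X u ∂(Measure.pi fun _ => ν) = 0
  mom2 : ∫ u : Fin N → V, avg X u ^ 2 ∂(Measure.pi fun _ => ν) = (∫ v, X v ^ 2 ∂ν) / N
  mom3 : ∫ u : Fin N → V, avg X u ^ 3 ∂(Measure.pi fun _ => ν) = (∫ v, X v ^ 3 ∂ν) / N ^ 2
  mom4 : ∫ u : Fin N → V, avg X u ^ 4 ∂(Measure.pi fun _ => ν) ≤ 3 * (∫ v, X v ^ 4 ∂ν) / N ^ 2
  mom6 : ∫ u : Fin N → V, avg X u ^ 6 ∂(Measure.pi fun _ => ν) ≤ 15 * (∫ v, X v ^ 6 ∂ν) / N ^ 3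

lemma avgMomentBounds (hN : 0 < N) (hX : Measurable X) (h6 : Integrable (fun v => X v ^ 6) ν)
    (h1 : ∫ v, X v ∂ν = 0) : AvgMomentBounds ν X N := by
  have hN' : (0 : ℝ) < N := by exact_mod_cast hN
  have h := sumMomentBounds_pi (ι := Fin N) hX h6 h1
  have e : ∀ r, ∫ u : Fin N → V, avg X u ^ r ∂(Measure.pi fun _ => ν)
      = ((N : ℝ)⁻¹) ^ r * ∫ u : Fin N → V, (∑ i, X (u i)) ^ r ∂(Measure.pi fun _ => ν) :=
    fun r => by simp_rw [avg, mul_pow, integral_const_mul]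
  rw [Fintype.card_fin] at h
  refine ⟨fun r hr => ?_, ?_, ?_, ?_, ?_, ?_⟩
  · simp_rw [avg, mul_pow]
    refine (integrable_pow_of_integrable_pow_six ?_ h.int6 hr).const_mul _
    exact (by fun_prop : Measurable fun u : Fin N → V => ∑ i, X (u i)).aestronglyMeasurable
  · simp_rw [avg, integral_const_mul, h.mom1, mul_zero]
  · rw [e, h.mom2]
    field_simp
  · rw [e, h.mom3]
    field_simp
  · rw [e]
    refine (mul_le_mul_of_nonneg_left h.mom4 (by positivity)).trans (le_of_eq ?_)
    field_simp
  · rw [e]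
    refine (mul_le_mul_of_nonneg_left h.mom6 (by positivity)).trans (le_of_eq ?_)
    field_simp

lemma abs_integral_cube_le (hX : Measurable X) (h6 : Integrable (fun v => X v ^ 6) ν) :
    |∫ v, X v ^ 3 ∂ν| ≤ 1 + ∫ v, X v ^ 6 ∂ν := by
  have h := sq_integral_cube_le hX.aestronglyMeasurable h6
  rw [abs_le]
  constructor <;> nlinarith [sq_nonneg ((∫ v, X v ^ 3 ∂ν) - 1), sq_nonneg ((∫ v, X v ^ 3 ∂ν) + 1)]

lemma integral_pow_four_le (hX : Measurable X) (h6 : Integrable (fun v => X v ^ 6) ν) :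
    ∫ v, X v ^ 4 ∂ν ≤ 1 + ∫ v, X v ^ 6 ∂ν := by
  have i4 := integrable_pow_of_integrable_pow_six hX.aestronglyMeasurable h6 (r := 4) (by norm_num)
  have h := integral_mono i4 ((integrable_const 1).add h6) (fun v => by
    simp only [Pi.add_apply]
    have h2 : 0 ≤ X v ^ 2 := sq_nonneg _
    rcases le_total (X v ^ 2) 1 with h | h <;> nlinarith [mul_nonneg h2 h2])
  rw [integral_add' (integrable_const _) h6] at h
  simpa using h

/-- The modulus is `(1 + avg X u) ^ j`, which has mean one for `j = 0` and `j = 1`. The bound by one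
is what the telescoping of products needs. -/
lemma integrable_tiltedPhase_one_add_avg (hN : 0 < N) {j : ℕ} (hj : j ≤ 1) (b : ℝ)
    (hX : Measurable X) (hX0 : ∀ v, -1 ≤ X v) (h6 : Integrable (fun v => X v ^ 6) ν)
    (h1 : ∫ v, X v ∂ν = 0) :
    Integrable (fun u : Fin N → V => tiltedPhase j b (1 + avg X u)) (Measure.pi fun _ => ν) ∧
    ‖∫ u : Fin N → V, tiltedPhase j b (1 + avg X u) ∂(Measure.pi fun _ => ν)‖ ≤ 1 := by
  have hM := avgMomentBounds hN hX h6 h1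
  have i1 : Integrable (fun u : Fin N → V => avg X u) (Measure.pi fun _ => ν) := by
    simpa using hM.int 1 (by norm_num)
  have hn : ∀ u : Fin N → V, ‖tiltedPhase j b (1 + avg X u)‖ = (1 + avg X u) ^ j := fun u =>
    norm_tiltedPhase j b (by linarith [neg_one_le_avg hN hX0 u])
  have hi : Integrable (fun u : Fin N → V => (1 + avg X u) ^ j) (Measure.pi fun _ => ν) := by
    interval_cases j
    · simp
    · simpa using (integrable_const 1).add i1
  have hI : ∫ u : Fin N → V, (1 + avg X u) ^ j ∂(Measure.pi fun _ => ν) = 1 := by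
    interval_cases j
    · simp
    · simp only [pow_one]
      rw [integral_add (integrable_const _) i1, hM.mom1]
      simp
  refine ⟨hi.mono' ((measurable_tiltedPhase j b).comp
    ((measurable_avg hX).const_add 1)).aestronglyMeasurable (ae_of_all _ fun u => (hn u).le), ?_⟩
  refine (norm_integral_le_integral_norm _).trans ?_
  simp_rw [hn, hI]
  exact le_rfl

/-- The expectation of `(1 + e) ^ (j + i b)` for an average `e` of i.i.d. centred variables. -/
lemma norm_integral_tiltedPhase_sub_exp_le (hN : 0 < N) {j : ℕ} (hj : j ≤ 1) {b s : ℝ}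
    (hb : |b| ≤ s) (hX : Measurable X) (hX0 : ∀ v, -1 ≤ X v)
    (h6 : Integrable (fun v => X v ^ 6) ν) (h1 : ∫ v, X v ∂ν = 0) :
    ‖∫ u : Fin N → V, tiltedPhase j b (1 + avg X u) ∂(Measure.pi fun _ => ν)
        - Complex.exp (phaseCoeff j b * ((∫ v, X v ^ 2 ∂ν) / N : ℝ))‖
      ≤ 4096 * (3 + s) ^ 3 * ((1 + ∫ v, X v ^ 6 ∂ν) * (|b| / N ^ 2 + 1 / N ^ 3)) := by
  have hM := avgMomentBounds hN hX h6 h1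
  have hN' : (0 : ℝ) < N := by exact_mod_cast hN
  have hs : 0 ≤ s := (abs_nonneg b).trans hb
  set π := Measure.pi fun _ : Fin N => ν
  set z : ℂ := j + b * Complex.I with hz
  set m2 := ∫ v, X v ^ 2 ∂ν
  set m3 := ∫ v, X v ^ 3 ∂ν
  set m4 := ∫ v, X v ^ 4 ∂ν
  set m6 := ∫ v, X v ^ 6 ∂ν
  set q := 3 + s with hq
  set c : ℂ := phaseCoeff j b * (m2 / N : ℝ) with hc
  have p2 : 0 ≤ m2 := integral_nonneg fun v => by positivity
  have p4 : 0 ≤ m4 := integral_nonneg fun v => by positivity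
  have p6 : 0 ≤ m6 := integral_nonneg fun v => by positivity
  have b3 : |m3| ≤ 1 + m6 := abs_integral_cube_le hX h6
  have b4 : m4 ≤ 1 + m6 := integral_pow_four_le hX h6
  have b2 : m2 ^ 2 ≤ m4 := sq_integral_sq_le hX.aestronglyMeasurable h6
  have n01 : ‖z‖ * ‖z - 1‖ ≤ |b| * q :=
    (norm_natCast_add_mul_I_mul_sub_one_le hj b).trans
      (mul_le_mul_of_nonneg_left (by linarith) (abs_nonneg b))
  have n2 : ‖z - 2‖ ≤ q := by
    have := norm_natCast_add_mul_I_sub_le hj b (c := 2) (by norm_num)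
    push_cast at this; linarith
  have q1 : 1 ≤ q := by linarith
  have ir : ∀ r ≤ 6, Integrable (fun u : Fin N → V => ((avg X u : ℝ) : ℂ) ^ r) π := fun r hr => by
    have := (hM.int r hr).ofReal (𝕜 := ℂ)
    simpa using this
  have Ir : ∀ r, ∫ u : Fin N → V, ((avg X u : ℝ) : ℂ) ^ r ∂π
      = ((∫ u : Fin N → V, avg X u ^ r ∂π : ℝ) : ℂ) := fun r => by
    rw [← integral_complex_ofReal]
    simp
  have i1 : Integrable (fun u : Fin N → V => ((avg X u : ℝ) : ℂ)) π := by
    simpa using ir 1 (by norm_num)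
  have I1 : ∫ u : Fin N → V, ((avg X u : ℝ) : ℂ) ∂π = 0 := by
    rw [integral_complex_ofReal, hM.mom1, Complex.ofReal_zero]
  have iT : Integrable (fun u : Fin N → V => binomTaylor z (avg X u)) π := by
    unfold binomTaylor
    exact (((integrable_const _).add (i1.const_mul _)).add ((ir 2 (by norm_num)).const_mul _)).add
      ((ir 3 (by norm_num)).const_mul _)
  have IT : ∫ u : Fin N → V, binomTaylor z (avg X u) ∂π
      = 1 + c + z * (z - 1) * (z - 2) / 6 * (m3 / N ^ 2 : ℝ) := by
    simp only [binomTaylor]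
    rw [integral_add, integral_add, integral_add, integral_const_mul, integral_const_mul,
      integral_const_mul, I1, Ir, Ir, hM.mom2, hM.mom3, hc, phaseCoeff, ← hz]
    · simp [m2, m3]
    · exact integrable_const _
    · exact i1.const_mul _
    · exact (integrable_const _).add (i1.const_mul _)
    · exact (ir 2 (by norm_num)).const_mul _
    · exact ((integrable_const _).add (i1.const_mul _)).add ((ir 2 (by norm_num)).const_mul _)
    · exact (ir 3 (by norm_num)).const_mul _
  have iF := (integrable_tiltedPhase_one_add_avg hN hj b hX hX0 h6 h1).1
  have i46 : Integrable (fun u : Fin N → V =>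
      256 * q ^ 3 * (|b| * avg X u ^ 4 + avg X u ^ 6)) π :=
    (((hM.int 4 (by norm_num)).const_mul _).add (hM.int 6 le_rfl)).const_mul _
  have d1 : ‖∫ u : Fin N → V, tiltedPhase j b (1 + avg X u) ∂π
      - ∫ u : Fin N → V, binomTaylor z (avg X u) ∂π‖
      ≤ 256 * q ^ 3 * (|b| * (3 * m4 / N ^ 2) + 15 * m6 / N ^ 3) := by
    rw [← integral_sub iF iT]
    refine (norm_integral_le_of_norm_le i46 (ae_of_all _ fun u =>
      norm_tiltedPhase_sub_binomTaylor_le hj hb (neg_one_le_avg hN hX0 u))).trans ?_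
    rw [integral_const_mul, integral_add ((hM.int 4 (by norm_num)).const_mul _) (hM.int 6 le_rfl),
      integral_const_mul]
    have := hM.mom4
    have := hM.mom6
    gcongr
  -- The third moment of an average is of order `N ^ (-2)`, and `z * (z - 1)` supplies the factor
  -- `|b|`.
  have d2 : ‖z * (z - 1) * (z - 2) / 6 * ((m3 / N ^ 2 : ℝ) : ℂ)‖
      ≤ q ^ 3 * ((1 + m6) * (|b| / N ^ 2)) := by
    rw [norm_mul, norm_div, norm_mul, norm_mul, Complex.norm_real, Complex.norm_ofNat,
      Real.norm_eq_abs, abs_div, abs_of_pos (by positivity : (0 : ℝ) < N ^ 2)]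
    have e1 : ‖z‖ * ‖z - 1‖ * ‖z - 2‖ / 6 ≤ |b| * q ^ 3 := by
      have := mul_le_mul n01 n2 (norm_nonneg _) (by positivity)
      have e2 : |b| * q * q ≤ |b| * q ^ 3 := by
        rw [mul_assoc, ← sq]
        exact mul_le_mul_of_nonneg_left (pow_le_pow_right₀ q1 (by norm_num)) (abs_nonneg b)
      have : 0 ≤ ‖z‖ * ‖z - 1‖ * ‖z - 2‖ := by positivity
      linarith
    refine (mul_le_mul e1 (div_le_div_of_nonneg_right b3 (by positivity)) (by positivity)
      (by positivity)).trans (le_of_eq ?_)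
    ring
  -- Here `‖c‖ ^ 2` is of order `b ^ 2 / N ^ 2`; one factor `|b|` is kept and the other absorbed
  -- into `q`.
  have d3 : ‖Complex.exp c - 1 - c‖ ≤ q ^ 3 * ((1 + m6) * (|b| / N ^ 2)) := by
    refine (norm_exp_sub_one_sub_le_of_re_nonpos ?_).trans ?_
    · rw [hc, Complex.re_mul_ofReal, phaseCoeff_re hj]
      have : 0 ≤ m2 / N := by positivity
      nlinarith [mul_nonneg (sq_nonneg b) this]
    · have hcn : ‖c‖ ≤ |b| * q / 2 * (m2 / N) := by
        rw [hc, norm_mul, Complex.norm_real, Real.norm_of_nonneg (by positivity), phaseCoeff,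
          norm_div, norm_mul, Complex.norm_ofNat]
        gcongr
      have h1 : ‖c‖ ^ 2 ≤ (|b| * q / 2 * (m2 / N)) ^ 2 := pow_le_pow_left₀ (norm_nonneg _) hcn 2
      have h2 : (|b| * q / 2 * (m2 / N)) ^ 2 = (|b| * q ^ 2) * (m2 ^ 2 * (|b| / N ^ 2)) / 4 := by
        field_simp
        ring
      have h3 : (|b| * q ^ 2) * (m2 ^ 2 * (|b| / N ^ 2)) ≤ q ^ 3 * ((1 + m6) * (|b| / N ^ 2)) := by
        have : |b| * q ^ 2 ≤ q ^ 3 := by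
          rw [pow_succ q 2, mul_comm]
          exact mul_le_mul_of_nonneg_left (by linarith) (by positivity)
        refine mul_le_mul this (mul_le_mul_of_nonneg_right (b2.trans b4) (by positivity))
          (by positivity) (by positivity)
      have h4 : 0 ≤ q ^ 3 * ((1 + m6) * (|b| / N ^ 2)) := by positivity
      linarith
  have tri : ‖∫ u : Fin N → V, tiltedPhase j b (1 + avg X u) ∂π - Complex.exp c‖
      ≤ 256 * q ^ 3 * (|b| * (3 * m4 / N ^ 2) + 15 * m6 / N ^ 3)
        + q ^ 3 * ((1 + m6) * (|b| / N ^ 2)) + q ^ 3 * ((1 + m6) * (|b| / N ^ 2)) := by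
    have e : ∫ u : Fin N → V, tiltedPhase j b (1 + avg X u) ∂π - Complex.exp c
        = (∫ u : Fin N → V, tiltedPhase j b (1 + avg X u) ∂π
            - ∫ u : Fin N → V, binomTaylor z (avg X u) ∂π)
          + z * (z - 1) * (z - 2) / 6 * ((m3 / N ^ 2 : ℝ) : ℂ) - (Complex.exp c - 1 - c) := by
      rw [IT]; ring
    rw [e]
    exact (norm_sub_le _ _).trans (add_le_add ((norm_add_le _ _).trans (add_le_add d1 d2)) d3)
  refine tri.trans ?_
  have x0 : 0 ≤ |b| / (N : ℝ) ^ 2 := by positivity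
  have y0 : 0 ≤ 1 / (N : ℝ) ^ 3 := by positivity
  have k1 : |b| * (3 * m4 / N ^ 2) ≤ 3 * ((1 + m6) * (|b| / N ^ 2)) := by
    have := mul_le_mul_of_nonneg_right b4 x0
    calc |b| * (3 * m4 / N ^ 2) = 3 * (m4 * (|b| / N ^ 2)) := by ring
      _ ≤ _ := by linarith
  have k2 : 15 * m6 / N ^ 3 ≤ 15 * ((1 + m6) * (1 / N ^ 3)) := by
    have := mul_le_mul_of_nonneg_right (show m6 ≤ 1 + m6 by linarith) y0
    calc 15 * m6 / N ^ 3 = 15 * (m6 * (1 / N ^ 3)) := by ring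
      _ ≤ _ := by linarith
  have x1 : 0 ≤ (1 + m6) * (|b| / (N : ℝ) ^ 2) := by positivity
  have y1 : 0 ≤ (1 + m6) * (1 / (N : ℝ) ^ 3) := by positivity
  have q3 : 0 ≤ q ^ 3 := by positivity
  have := mul_le_mul_of_nonneg_left (add_le_add k1 k2) q3
  have := mul_nonneg q3 x1
  have := mul_nonneg q3 y1
  nlinarith

end Factor


/-! ### The product over observations and its Gaussian limit. -/

lemma norm_exp_sub_exp_le_of_re_nonpos {w w' : ℂ} (hw : w.re ≤ 0) (hw' : w'.re ≤ 0) :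
    ‖Complex.exp w - Complex.exp w'‖ ≤ ‖w - w'‖ := by
  have := Convex.norm_image_sub_le_of_norm_hasDerivWithin_le (𝕜 := ℂ) (f := Complex.exp)
    (f' := Complex.exp) (s := {z : ℂ | z.re ≤ 0}) (x := w') (y := w) (C := 1)
    (fun x _ => (Complex.hasDerivAt_exp x).hasDerivWithinAt)
    (fun x hx => by rw [Complex.norm_exp]; exact Real.exp_le_one_iff.2 hx)
    (convex_halfSpace_re_le 0) hw' hw
  simpa using this

section Product

variable {ι V : Type*} [Fintype ι] [MeasurableSpace V] {ν : Measure V} [IsProbabilityMeasure ν]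
  {X : ι → V → ℝ} {N : ℕ}

/-- The two expressions agree when all factors are positive. If some `x t = 0`, the convention `log
0 = 0` breaks the additivity of the logarithm, but then `(x t - 1) ^ 6 = 1` pays for a difference of
at most two. -/
lemma norm_prod_mul_exp_sub_prod_tiltedPhase_le {j : ℕ} (hj : j ≤ 1) (b : ℝ) {x : ι → ℝ}
    (hx : ∀ t, 0 ≤ x t) {L : ℝ} (hL : (∀ t, 0 < x t) → L = Real.log (∏ t, x t)) :
    ‖((∏ t, x t ^ j : ℝ) : ℂ) * Complex.exp (b * L * Complex.I) - ∏ t, tiltedPhase j b (x t)‖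
      ≤ 2 * ∑ t, (x t - 1) ^ 6 := by
  have h0 : 0 ≤ ∑ t, (x t - 1) ^ 6 := Finset.sum_nonneg fun t _ => by positivity
  by_cases h : ∀ t, 0 < x t
  · rw [hL h, Real.log_prod (fun t _ => (h t).ne')]
    simp only [tiltedPhase]
    rw [Finset.prod_mul_distrib, ← Complex.exp_sum, ← Finset.sum_mul]
    push_cast
    rw [Finset.mul_sum, sub_self, norm_zero]
    linarith
  · push Not at h
    obtain ⟨t, ht⟩ := h
    have ht0 : x t = 0 := le_antisymm ht (hx t)
    have h1 : 1 ≤ ∑ t, (x t - 1) ^ 6 :=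
      calc (1 : ℝ) = (x t - 1) ^ 6 := by rw [ht0]; norm_num
        _ ≤ _ := Finset.single_le_sum (f := fun t => (x t - 1) ^ 6) (fun t _ => by positivity)
          (Finset.mem_univ t)
    interval_cases j
    · refine (norm_sub_le _ _).trans ?_
      have e1 : ‖∏ t, tiltedPhase 0 b (x t)‖ ≤ 1 := by
        rw [norm_prod]
        exact Finset.prod_le_one (fun _ _ => norm_nonneg _) fun t _ => by
          rw [norm_tiltedPhase 0 b (hx t), pow_zero]
      have e2 : ‖((∏ t : ι, x t ^ 0 : ℝ) : ℂ) * Complex.exp (b * L * Complex.I)‖ = 1 := by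
        rw [norm_mul, ← Complex.ofReal_mul, Complex.norm_exp_ofReal_mul_I]
        simp
      linarith
    · have e1 : ∏ t, tiltedPhase 1 b (x t) = 0 :=
        Finset.prod_eq_zero (Finset.mem_univ t) (by simp [tiltedPhase, ht0])
      have e2 : ∏ t, x t ^ 1 = 0 := Finset.prod_eq_zero (Finset.mem_univ t) (by simp [ht0])
      rw [e1, e2]
      simp only [Complex.ofReal_zero, zero_mul, sub_zero, norm_zero]
      linarith

/-- The characteristic function of the logarithm of a product of averages of independent
variables with mean one, possibly tilted by that product. -/
lemma norm_integral_prod_mul_exp_sub_exp_le (hN : 0 < N) {j : ℕ} (hj : j ≤ 1) {b s : ℝ}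
    (hb : |b| ≤ s) (hX : ∀ t, Measurable (X t)) (hX0 : ∀ t v, -1 ≤ X t v)
    (h6 : ∀ t, Integrable (fun v => X t v ^ 6) ν) (h1 : ∀ t, ∫ v, X t v ∂ν = 0)
    {L : (ι → Fin N → V) → ℝ} (hLm : Measurable L)
    (hL : ∀ u, (∀ t, 0 < 1 + avg (X t) (u t)) → L u = Real.log (∏ t, (1 + avg (X t) (u t)))) :
    ‖∫ u, ((∏ t, (1 + avg (X t) (u t)) ^ j : ℝ) : ℂ) * Complex.exp (b * L u * Complex.I)
        ∂(Measure.pi fun _ : ι => Measure.pi fun _ : Fin N => ν)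
      - Complex.exp (phaseCoeff j b * ((∑ t, ∫ v, X t v ^ 2 ∂ν) / N : ℝ))‖
      ≤ (30 + 4096 * (3 + s) ^ 3)
        * ((∑ t, (1 + ∫ v, X t v ^ 6 ∂ν)) * (|b| / N ^ 2 + 1 / N ^ 3)) := by
  have hN' : (0 : ℝ) < N := by exact_mod_cast hN
  set π := Measure.pi fun _ : Fin N => ν with hπ
  have hmp := fun t : ι => measurePreserving_eval (fun _ : ι => π) t
  have p6 : ∀ t, 0 ≤ ∫ v, X t v ^ 6 ∂ν := fun t => integral_nonneg fun v => by positivity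
  have iprod : Integrable (fun u : ι → Fin N → V => ∏ t, tiltedPhase j b (1 + avg (X t) (u t)))
      (Measure.pi fun _ : ι => π) :=
    Integrable.fintype_prod (f := fun t u => tiltedPhase j b (1 + avg (X t) u)) fun t =>
      (integrable_tiltedPhase_one_add_avg hN hj b (hX t) (hX0 t) (h6 t) (h1 t)).1
  have bd : ∀ u : ι → Fin N → V, ‖((∏ t, (1 + avg (X t) (u t)) ^ j : ℝ) : ℂ)
      * Complex.exp (b * L u * Complex.I) - ∏ t, tiltedPhase j b (1 + avg (X t) (u t))‖
      ≤ 2 * ∑ t, avg (X t) (u t) ^ 6 := fun u => by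
    have := norm_prod_mul_exp_sub_prod_tiltedPhase_le hj b
      (x := fun t => 1 + avg (X t) (u t)) (fun t => by
        linarith [neg_one_le_avg hN (hX0 t) (u t)]) (hL u)
    simpa using this
  have iavg : ∀ t, Integrable (fun u : ι → Fin N → V => avg (X t) (u t) ^ 6)
      (Measure.pi fun _ : ι => π) := fun t =>
    (hmp t).integrable_comp_of_integrable
      ((avgMomentBounds hN (hX t) (h6 t) (h1 t)).int 6 le_rfl)
  have isum : Integrable (fun u : ι → Fin N → V => 2 * ∑ t, avg (X t) (u t) ^ 6)
      (Measure.pi fun _ : ι => π) :=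
    (integrable_finsetSum _ fun t _ => iavg t).const_mul 2
  have hmeas : Measurable fun u : ι → Fin N → V => ((∏ t, (1 + avg (X t) (u t)) ^ j : ℝ) : ℂ)
      * Complex.exp (b * L u * Complex.I) := by
    have : ∀ t, Measurable fun u : ι → Fin N → V => avg (X t) (u t) := fun t =>
      (measurable_avg (hX t)).comp (measurable_pi_apply t)
    fun_prop
  have idiff := isum.mono' (hmeas.aestronglyMeasurable.sub iprod.1) (ae_of_all _ bd)
  have iL : Integrable (fun u : ι → Fin N → V => ((∏ t, (1 + avg (X t) (u t)) ^ j : ℝ) : ℂ)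
      * Complex.exp (b * L u * Complex.I)) (Measure.pi fun _ : ι => π) := by
    refine (idiff.add iprod).congr (ae_of_all _ fun u => ?_)
    simp
  have key : ∀ t, ∫ u : ι → Fin N → V, avg (X t) (u t) ^ 6 ∂(Measure.pi fun _ : ι => π)
      ≤ 15 * ((1 + ∫ v, X t v ^ 6 ∂ν) * (|b| / N ^ 2 + 1 / N ^ 3)) := by
    intro t
    have h := integral_map (μ := Measure.pi fun _ : ι => π) (hmp t).measurable.aemeasurable
      (f := fun u => avg (X t) u ^ 6) ((measurable_avg (hX t)).pow_const 6).aestronglyMeasurable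
    rw [(hmp t).map_eq] at h
    refine (h.symm.le.trans (avgMomentBounds hN (hX t) (h6 t) (h1 t)).mom6).trans ?_
    have x0 : 0 ≤ (1 + ∫ v, X t v ^ 6 ∂ν) * (|b| / (N : ℝ) ^ 2) := by
      have := p6 t
      positivity
    have y0 : 0 ≤ 1 / (N : ℝ) ^ 3 := by positivity
    have : 15 * (∫ v, X t v ^ 6 ∂ν) / (N : ℝ) ^ 3 = 15 * ((∫ v, X t v ^ 6 ∂ν) * (1 / N ^ 3)) := by
      ring
    rw [this, mul_add]
    nlinarith [p6 t]
  have step1 : ‖∫ u, ((∏ t, (1 + avg (X t) (u t)) ^ j : ℝ) : ℂ) * Complex.exp (b * L u * Complex.I)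
        ∂(Measure.pi fun _ : ι => π)
      - ∏ t, ∫ u, tiltedPhase j b (1 + avg (X t) u) ∂π‖
      ≤ 30 * ((∑ t, (1 + ∫ v, X t v ^ 6 ∂ν)) * (|b| / N ^ 2 + 1 / N ^ 3)) := by
    rw [← integral_fintype_prod_eq_prod (fun t u => tiltedPhase j b (1 + avg (X t) u)),
      ← integral_sub iL iprod]
    refine (norm_integral_le_of_norm_le isum (ae_of_all _ bd)).trans ?_
    rw [integral_const_mul, integral_finsetSum _ fun t _ => iavg t, Finset.sum_mul]
    have := Finset.sum_le_sum fun t (_ : t ∈ Finset.univ) => key t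
    rw [← Finset.mul_sum] at this
    linarith
  have step2 : ‖∏ t, ∫ u, tiltedPhase j b (1 + avg (X t) u) ∂π
      - Complex.exp (phaseCoeff j b * ((∑ t, ∫ v, X t v ^ 2 ∂ν) / N : ℝ))‖
      ≤ 4096 * (3 + s) ^ 3 * ((∑ t, (1 + ∫ v, X t v ^ 6 ∂ν)) * (|b| / N ^ 2 + 1 / N ^ 3)) := by
    have e : Complex.exp (phaseCoeff j b * ((∑ t, ∫ v, X t v ^ 2 ∂ν) / N : ℝ))
        = ∏ t, Complex.exp (phaseCoeff j b * ((∫ v, X t v ^ 2 ∂ν) / N : ℝ)) := by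
      rw [← Complex.exp_sum, ← Finset.mul_sum, Finset.sum_div]
      push_cast
      rfl
    rw [e, Finset.sum_mul, Finset.mul_sum]
    refine (norm_prod_sub_prod_le _ (fun t _ =>
      (integrable_tiltedPhase_one_add_avg hN hj b (hX t) (hX0 t) (h6 t) (h1 t)).2)
      fun t _ => ?_).trans (Finset.sum_le_sum fun t _ =>
        norm_integral_tiltedPhase_sub_exp_le hN hj hb (hX t) (hX0 t) (h6 t) (h1 t))
    rw [Complex.norm_exp, Complex.re_mul_ofReal, phaseCoeff_re hj]
    refine Real.exp_le_one_iff.2 ?_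
    have : 0 ≤ (∫ v, X t v ^ 2 ∂ν) / (N : ℝ) :=
      div_nonneg (integral_nonneg fun v => by positivity) hN'.le
    nlinarith [mul_nonneg (sq_nonneg b) this]
  refine (norm_sub_le_norm_sub_add_norm_sub _ (∏ t, ∫ u, tiltedPhase j b (1 + avg (X t) u) ∂π)
    _).trans ((add_le_add step1 step2).trans (le_of_eq ?_))
  ring

end Product

/-- Comparison of the characteristic exponent with the Gaussian one. -/
lemma norm_exp_phaseCoeff_sub_exp_le {j : ℕ} (hj : j ≤ 1) (s : ℝ) {a a' H v : ℝ} (ha : 0 ≤ a)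
    (ha1 : a ≤ 1) (haa : a * a' = 1) (hH : 0 ≤ H) (hv : 0 ≤ v) :
    ‖Complex.exp (s * (-(2 * j - 1) * (a' * v / 2) : ℝ) * Complex.I + phaseCoeff j (s * a) * (H : ℝ))
        - Complex.exp (-(s ^ 2 * v / 2 : ℝ))‖ ≤ (s ^ 2 + |s|) * |a * H - a' * v| := by
  refine (norm_exp_sub_exp_le_of_re_nonpos ?_ ?_).trans ?_
  · rw [Complex.add_re, Complex.re_mul_ofReal, phaseCoeff_re hj, ← Complex.ofReal_mul,
      Complex.re_ofReal_mul, Complex.I_re]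
    nlinarith [mul_nonneg (sq_nonneg (s * a)) hH]
  · rw [← Complex.ofReal_neg, Complex.ofReal_re]
    nlinarith [mul_nonneg (sq_nonneg s) hv]
  · have e : (s * (-(2 * j - 1) * (a' * v / 2) : ℝ) * Complex.I + phaseCoeff j (s * a) * (H : ℝ))
        - (-(s ^ 2 * v / 2 : ℝ)) = ((-(s ^ 2 / 2) * a * (a * H - a' * v) : ℝ) : ℂ)
          + (((2 * j - 1) * s / 2 * (a * H - a' * v) : ℝ) : ℂ) * Complex.I := by
      have h2 : (a : ℂ) * a' = 1 := by exact_mod_cast haa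
      rw [phaseCoeff_eq hj]
      push_cast
      linear_combination (-(s : ℂ) ^ 2 * v / 2) * h2
    rw [e]
    refine (norm_add_le _ _).trans ?_
    have hj' : |(2 * j - 1 : ℝ)| = 1 := by interval_cases j <;> norm_num
    rw [norm_mul, Complex.norm_I, mul_one, Complex.norm_real, Complex.norm_real, Real.norm_eq_abs,
      Real.norm_eq_abs, abs_mul, abs_mul _ (a * H - a' * v), abs_mul, abs_div, abs_mul, hj',
      abs_neg, abs_of_nonneg (by positivity : 0 ≤ s ^ 2 / 2), abs_of_nonneg ha, abs_two, one_mul,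
      ← add_mul]
    refine mul_le_mul_of_nonneg_right ?_ (abs_nonneg _)
    nlinarith [sq_nonneg s, abs_nonneg s, mul_le_mul_of_nonneg_left ha1 (sq_nonneg s)]


/-! ### Rates of the error terms for `N = ⌈β T ^ α⌉`. -/

section Asymptotics

variable {α β : ℝ}

lemma mul_rpow_le_numSamples (T : ℕ) : β * (T : ℝ) ^ α ≤ numSamples β α T := Nat.le_ceil _

lemma numSamples_le (hβ : 0 < β) (T : ℕ) : (numSamples β α T : ℝ) ≤ β * (T : ℝ) ^ α + 1 :=
  (Nat.ceil_lt_add_one (by positivity)).le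

lemma numSamples_pos (hβ : 0 < β) {T : ℕ} (hT : 0 < T) : 0 < numSamples β α T :=
  Nat.ceil_pos.2 (mul_pos hβ (Real.rpow_pos_of_pos (by exact_mod_cast hT) _))

lemma tendsto_natCast_rpow_of_neg {c : ℝ} (hc : c < 0) :
    Tendsto (fun T : ℕ => (T : ℝ) ^ c) atTop (𝓝 0) := by
  have := (tendsto_rpow_neg_atTop (y := -c) (by linarith)).comp tendsto_natCast_atTop_atTop
  simpa [Function.comp_def] using this

lemma tendsto_sqrt_mul_rpow_div_numSamples (hα : 1 / 3 < α) (hβ : 0 < β) :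
    Tendsto (fun T : ℕ => (T : ℝ) ^ ((α - 1) / 2) * √T / numSamples β α T) atTop (𝓝 0) := by
  have h := (tendsto_natCast_rpow_of_neg (c := -α / 2) (by linarith)).const_mul β⁻¹
  rw [mul_zero] at h
  refine squeeze_zero' (Eventually.of_forall fun T => by positivity) ?_ h
  filter_upwards [eventually_gt_atTop 0] with T hT
  have hT' : (0 : ℝ) < T := by exact_mod_cast hT
  refine (div_le_div_of_nonneg_left (by positivity) (by positivity)
    (mul_rpow_le_numSamples (α := α) (β := β) T)).trans (le_of_eq ?_)
  rw [Real.sqrt_eq_rpow, ← Real.rpow_add hT', mul_comm β, ← div_div, ← Real.rpow_sub hT',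
    div_eq_inv_mul]
  congr 2
  ring

/-- With `N ≥ β T ^ α`, the two terms are of order `T ^ ((1 - 3α) / 2)` and `T ^ (1 - 3α)`. -/
lemma tendsto_error_rate (hα : 1 / 3 < α) (hβ : 0 < β) (s : ℝ) :
    Tendsto (fun T : ℕ => (T : ℝ) * (|s| * (T : ℝ) ^ ((α - 1) / 2) / (numSamples β α T : ℝ) ^ 2
      + 1 / (numSamples β α T : ℝ) ^ 3)) atTop (𝓝 0) := by
  have h1 := (tendsto_natCast_rpow_of_neg (c := (1 - 3 * α) / 2) (by linarith)).const_mul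
    (|s| * (β ^ 2)⁻¹)
  have h2 := (tendsto_natCast_rpow_of_neg (c := 1 - 3 * α) (by linarith)).const_mul ((β ^ 3)⁻¹)
  have h := h1.add h2
  rw [mul_zero, mul_zero, add_zero] at h
  refine squeeze_zero' (Eventually.of_forall fun T => by positivity) ?_ h
  filter_upwards [eventually_gt_atTop 0] with T hT
  have hT' : (0 : ℝ) < T := by exact_mod_cast hT
  have hp : 0 < β * (T : ℝ) ^ α := by positivity
  have hle := mul_rpow_le_numSamples (α := α) (β := β) T
  have e2 : |s| * (T : ℝ) ^ ((α - 1) / 2) / (numSamples β α T : ℝ) ^ 2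
      ≤ |s| * (T : ℝ) ^ ((α - 1) / 2) / (β * (T : ℝ) ^ α) ^ 2 := by gcongr
  have e3 : 1 / (numSamples β α T : ℝ) ^ 3 ≤ 1 / (β * (T : ℝ) ^ α) ^ 3 := by gcongr
  refine (mul_le_mul_of_nonneg_left (add_le_add e2 e3) hT'.le).trans (le_of_eq ?_)
  have k2 : (T : ℝ) ^ ((1 - 3 * α) / 2) * ((T : ℝ) ^ α) ^ 2 = T * (T : ℝ) ^ ((α - 1) / 2) := by
    rw [← Real.rpow_natCast, ← Real.rpow_mul hT'.le, ← Real.rpow_add hT']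
    nth_rewrite 2 [← Real.rpow_one (T : ℝ)]
    rw [← Real.rpow_add hT']
    congr 1
    push_cast
    ring
  have k3 : (T : ℝ) ^ (1 - 3 * α) * ((T : ℝ) ^ α) ^ 3 = T := by
    rw [← Real.rpow_natCast, ← Real.rpow_mul hT'.le, ← Real.rpow_add hT']
    nth_rewrite 2 [← Real.rpow_one (T : ℝ)]
    congr 1
    push_cast
    ring
  generalize (T : ℝ) ^ ((1 - 3 * α) / 2) = r2 at k2 ⊢
  generalize (T : ℝ) ^ (1 - 3 * α) = r3 at k3 ⊢
  generalize (T : ℝ) ^ ((α - 1) / 2) = r at k2 ⊢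
  rw [mul_add]
  congr 1
  · field_simp
    linear_combination (-|s|) * k2
  · field_simp
    linear_combination -k3

/-- Rounding moves `N` by at most one, which shifts the diverging drift by at most a multiple of `T
^ ((1 - 3α) / 2)`. -/
lemma tendsto_rounding_error (hα : 1 / 3 < α) (hβ : 0 < β) :
    Tendsto (fun T : ℕ => |(T : ℝ) ^ ((α - 1) / 2) * T / numSamples β α T
      - (T : ℝ) ^ ((1 - α) / 2) / β|) atTop (𝓝 0) := by
  have h := (tendsto_natCast_rpow_of_neg (c := (1 - 3 * α) / 2) (by linarith)).const_mul
    ((β ^ 2)⁻¹)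
  rw [mul_zero] at h
  refine squeeze_zero' (Eventually.of_forall fun T => abs_nonneg _) ?_ h
  filter_upwards [eventually_gt_atTop 0] with T hT
  have hT' : (0 : ℝ) < T := by exact_mod_cast hT
  have hp : 0 < β * (T : ℝ) ^ α := by positivity
  have hle := mul_rpow_le_numSamples (α := α) (β := β) T
  have hge := numSamples_le (α := α) hβ T
  set N := (numSamples β α T : ℝ)
  have hN : 0 < N := hp.trans_le hle
  have k1 : (T : ℝ) ^ ((1 - α) / 2) * (T : ℝ) ^ α = (T : ℝ) ^ ((α - 1) / 2) * T := by
    rw [← Real.rpow_add hT']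
    nth_rewrite 3 [← Real.rpow_one (T : ℝ)]
    rw [← Real.rpow_add hT']
    congr 1
    ring
  have k2 : (T : ℝ) ^ ((1 - 3 * α) / 2) * (T : ℝ) ^ α = (T : ℝ) ^ ((1 - α) / 2) := by
    rw [← Real.rpow_add hT']
    congr 1
    ring
  rw [← k1, ← k2]
  set r := (T : ℝ) ^ ((1 - 3 * α) / 2)
  set t := (T : ℝ) ^ α
  have hr : 0 < r := by positivity
  have ht : 0 < t := by positivity
  have e : r * t * t / N - r * t / β = -(r * t * (N - β * t) / (β * N)) := by
    field_simp
    ring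
  rw [e, abs_neg, abs_of_nonneg (div_nonneg (mul_nonneg (by positivity) (by linarith))
    (by positivity)), div_le_iff₀ (by positivity)]
  have : (β ^ 2)⁻¹ * r * (β * N) = r * (N / β) := by
    field_simp
  rw [this]
  have h1 : t ≤ N / β := by
    rw [le_div_iff₀ hβ]
    linarith
  have h2 : t * (N - β * t) ≤ t * 1 := mul_le_mul_of_nonneg_left (by linarith) ht.le
  calc r * t * (N - β * t) = r * (t * (N - β * t)) := by ring
    _ ≤ r * (N / β) := mul_le_mul_of_nonneg_left (by linarith) hr.le

end Asymptotics

/-! ### Fluctuations of i.i.d. sums over the data. -/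

section SumDeviation

variable {E : Type*} [MeasurableSpace E] {μ : Measure E} [IsProbabilityMeasure μ]

lemma integrable_sum_pi {h : E → ℝ} (hh : Integrable h μ) (T : ℕ) :
    Integrable (fun y : Fin T → E => ∑ t, h (y t)) (Measure.pi fun _ => μ) :=
  integrable_finsetSum _ fun t _ =>
    (measurePreserving_eval (fun _ : Fin T => μ) t).integrable_comp_of_integrable hh

lemma integral_sum_pi {h : E → ℝ} (hh : Integrable h μ) (T : ℕ) :
    ∫ y : Fin T → E, ∑ t, h (y t) ∂(Measure.pi fun _ => μ) = T * ∫ y, h y ∂μ := by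
  have mp := fun t : Fin T => measurePreserving_eval (fun _ : Fin T => μ) t
  have hi : ∀ t ∈ Finset.univ, Integrable (fun y : Fin T → E => h (y t))
      (Measure.pi fun _ => μ) := fun t _ => (mp t).integrable_comp_of_integrable hh
  rw [integral_finsetSum _ hi]
  have : ∀ t : Fin T, ∫ y : Fin T → E, h (y t) ∂(Measure.pi fun _ => μ) = ∫ y, h y ∂μ := by
    intro t
    have e := integral_map (μ := Measure.pi fun _ : Fin T => μ) (mp t).measurable.aemeasurable
      (f := h) (by rw [(mp t).map_eq]; exact hh.1)
    rw [(mp t).map_eq] at e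
    exact e.symm
  simp [this]

/-- The mean absolute deviation of an i.i.d. sum is of the order of the square root of the number
of terms. -/
lemma integral_abs_sum_sub_le {h : E → ℝ} (hh : MemLp h 2 μ) {T : ℕ} (hT : 0 < T) :
    Integrable (fun y : Fin T → E => |∑ t, h (y t) - T * ∫ y, h y ∂μ|) (Measure.pi fun _ => μ) ∧
    ∫ y : Fin T → E, |∑ t, h (y t) - T * ∫ y, h y ∂μ| ∂(Measure.pi fun _ => μ)
      ≤ √T * (1 + Var[h; μ]) := by
  have hT' : (0 : ℝ) < T := by exact_mod_cast hT
  have hi : Integrable h μ := hh.integrable (by norm_num)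
  have isub : Integrable (fun y : Fin T → E => ∑ t, h (y t) - T * ∫ y, h y ∂μ)
      (Measure.pi fun _ => μ) := (integrable_sum_pi hi T).sub (integrable_const _)
  refine ⟨isub.abs, ?_⟩
  have hS : MemLp (fun y : Fin T → E => ∑ t, h (y t)) 2 (Measure.pi fun _ => μ) :=
    memLp_finsetSum _ fun t _ =>
      hh.comp_measurePreserving (measurePreserving_eval (fun _ : Fin T => μ) t)
  have hvar : ∫ y : Fin T → E, (∑ t, h (y t) - T * ∫ y, h y ∂μ) ^ 2 ∂(Measure.pi fun _ => μ)
      = T * Var[h; μ] := by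
    have e1 := variance_sum_pi (μ := fun _ : Fin T => μ) (X := fun _ => h) (fun _ => hh)
    have e2 : (∑ t : Fin T, fun y : Fin T → E => h (y t)) = fun y => ∑ t, h (y t) := by
      ext y; simp
    rw [e2, variance_eq_integral hS.aemeasurable, integral_sum_pi hi] at e1
    rw [e1]
    simp
  have isq : Integrable (fun y : Fin T → E => (∑ t, h (y t) - T * ∫ y, h y ∂μ) ^ 2)
      (Measure.pi fun _ => μ) := (hS.sub (memLp_const _)).integrable_sq
  have hsq : 0 < √(T : ℝ) := Real.sqrt_pos.2 hT'
  have hss : √(T : ℝ) * √T = T := Real.mul_self_sqrt hT'.le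
  -- This replaces Cauchy–Schwarz: it bounds a first moment by the variance, with `√T` the scale
  -- that balances both terms.
  have bd : ∀ x : ℝ, |x| ≤ √T + x ^ 2 / √T := fun x => by
    have : √(T : ℝ) + x ^ 2 / √T = (√T * √T + |x| ^ 2) / √T := by
      rw [sq_abs]; field_simp
    rw [this, le_div_iff₀ hsq]
    nlinarith [sq_nonneg (√T - |x|), abs_nonneg x]
  refine (integral_mono isub.abs ((integrable_const (√T)).add (isq.div_const (√T)))
    fun y => bd _).trans (le_of_eq ?_)
  rw [integral_add' (integrable_const _) (isq.div_const _), integral_div, hvar]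
  simp only [integral_const, probReal_univ, smul_eq_mul]
  field_simp
  rw [Real.sq_sqrt hT'.le]
  ring

end SumDeviation


/-! ### Averaging the conditional bounds over the data. -/

section RandomWeights

variable {E V : Type*} [MeasurableSpace E] [MeasurableSpace V] {μ : Measure E}
  [IsProbabilityMeasure μ] {ν : Measure V} [IsProbabilityMeasure ν] {w : E → V → ℝ}

/-- The moment of order `r` of the centred weight `w y - 1`. -/
def weightMoment (ν : Measure V) (w : E → V → ℝ) (r : ℕ) (y : E) : ℝ := ∫ v, (w y v - 1) ^ r ∂ν

lemma measurable_weightMoment (hw : Measurable fun z : E × V => w z.1 z.2) (r : ℕ) :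
    Measurable (weightMoment ν w r) :=
  (StronglyMeasurable.integral_prod_right (f := fun y v => (w y v - 1) ^ r)
    ((hw.sub_const 1).pow_const r).stronglyMeasurable).measurable

lemma integrable_weightMoment_six {ρ : Measure E}
    (h6 : Integrable (fun z : E × V => (w z.1 z.2 - 1) ^ 6) (ρ.prod ν)) :
    Integrable (weightMoment ν w 6) ρ := h6.integral_prod_left

/-- Pointwise in `y`, `m2 ^ 2 ≤ m4 ≤ 1 + m6`, and the right side is integrable. -/
lemma memLp_weightMoment_two (hw : Measurable fun z : E × V => w z.1 z.2)
    (h6 : Integrable (fun z : E × V => (w z.1 z.2 - 1) ^ 6) (μ.prod ν)) :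
    MemLp (weightMoment ν w 2) 2 μ := by
  have hm := measurable_weightMoment (ν := ν) hw 2
  rw [memLp_two_iff_integrable_sq hm.aestronglyMeasurable]
  refine ((integrable_const 1).add (integrable_weightMoment_six h6)).mono'
    (hm.pow_const 2).aestronglyMeasurable ?_
  filter_upwards [h6.prod_right_ae] with y hy
  have hX : Measurable fun v => w y v - 1 := (hw.comp measurable_prodMk_left).sub_const 1
  rw [Real.norm_of_nonneg (sq_nonneg _)]
  exact (sq_integral_sq_le hX.aestronglyMeasurable hy).trans (integral_pow_four_le hX hy)

lemma ae_pi_of_ae {p : E → Prop} (h : ∀ᵐ y ∂μ, p y) (T : ℕ) :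
    ∀ᵐ y ∂(Measure.pi fun _ : Fin T => μ), ∀ t, p (y t) :=
  ae_all_iff.2 fun t =>
    (measurePreserving_eval (fun _ : Fin T => μ) t).quasiMeasurePreserving.ae h

/-- Quantitative `L¹` comparison of the conditional characteristic function of the rescaled and
recentred logarithm of a product of averages with a Gaussian characteristic function. -/
lemma integral_norm_condCharFun_sub_le {T N : ℕ} (hT : 0 < T) (hN : 0 < N) {j : ℕ} (hj : j ≤ 1)
    (s : ℝ) {a a' β : ℝ} (ha : 0 ≤ a) (ha1 : a ≤ 1) (haa : a * a' = 1) (hβ : 0 < β)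
    (hw : Measurable fun z : E × V => w z.1 z.2) (hw0 : ∀ y v, 0 ≤ w y v)
    (hmean : ∀ᵐ y ∂μ, ∫ v, w y v ∂ν = 1)
    (h6 : Integrable (fun z : E × V => (w z.1 z.2 - 1) ^ 6) (μ.prod ν))
    {L : (Fin T → E) → (Fin T → Fin N → V) → ℝ} (hLm : ∀ y, Measurable (L y))
    (hL : ∀ y u, (∀ t, 0 < 1 + avg (fun v => w (y t) v - 1) (u t)) →
      L y u = Real.log (∏ t, (1 + avg (fun v => w (y t) v - 1) (u t)))) :
    ∫ y, ‖Complex.exp (s * (-(2 * j - 1)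
            * (a' * (β⁻¹ * ∫ y, weightMoment ν w 2 y ∂μ) / 2) : ℝ) * Complex.I)
          * ∫ u, ((∏ t, (1 + avg (fun v => w (y t) v - 1) (u t)) ^ j : ℝ) : ℂ)
              * Complex.exp ((s * a : ℝ) * L y u * Complex.I)
            ∂(Measure.pi fun _ : Fin T => Measure.pi fun _ : Fin N => ν)
        - Complex.exp (-(s ^ 2 * (β⁻¹ * ∫ y, weightMoment ν w 2 y ∂μ) / 2 : ℝ))‖
        ∂(Measure.pi fun _ : Fin T => μ)
      ≤ (30 + 4096 * (3 + |s|) ^ 3) * ((∫ y, (1 + weightMoment ν w 6 y) ∂μ)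
          * (T * (|s| * a / N ^ 2 + 1 / N ^ 3)))
        + (s ^ 2 + |s|) * (a * √T / N * (1 + Var[weightMoment ν w 2; μ])
          + (∫ y, weightMoment ν w 2 y ∂μ) * |a * T / N - a' / β|) := by
  have hN' : (0 : ℝ) < N := by exact_mod_cast hN
  set g := ∫ y, weightMoment ν w 2 y ∂μ with hg
  have hg0 : 0 ≤ g := integral_nonneg fun y => integral_nonneg fun v => by positivity
  have i6 : Integrable (fun y => 1 + weightMoment ν w 6 y) μ :=
    (integrable_const 1).add (integrable_weightMoment_six h6)
  have h2 := memLp_weightMoment_two hw h6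
  obtain ⟨iabs, habs⟩ := integral_abs_sum_sub_le h2 hT
  rw [← hg] at iabs habs
  have isum := integrable_sum_pi i6 T
  set B : ℝ := 30 + 4096 * (3 + |s|) ^ 3 with hB
  set rate : ℝ := |s| * a / N ^ 2 + 1 / N ^ 3 with hrate
  have hbound : ∀ᵐ y ∂(Measure.pi fun _ : Fin T => μ),
      ‖Complex.exp (s * (-(2 * j - 1) * (a' * (β⁻¹ * g) / 2) : ℝ) * Complex.I)
          * ∫ u, ((∏ t, (1 + avg (fun v => w (y t) v - 1) (u t)) ^ j : ℝ) : ℂ)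
              * Complex.exp ((s * a : ℝ) * L y u * Complex.I)
            ∂(Measure.pi fun _ : Fin T => Measure.pi fun _ : Fin N => ν)
        - Complex.exp (-(s ^ 2 * (β⁻¹ * g) / 2 : ℝ))‖
      ≤ B * ((∑ t, (1 + weightMoment ν w 6 (y t))) * rate)
        + (s ^ 2 + |s|) * (a / N * |∑ t, weightMoment ν w 2 (y t) - T * g|
          + g * |a * T / N - a' / β|) := by
    filter_upwards [ae_pi_of_ae h6.prod_right_ae T, ae_pi_of_ae hmean T] with y hy6 hy1
    have hX : ∀ t, Measurable fun v => w (y t) v - 1 := fun t =>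
      (hw.comp measurable_prodMk_left).sub_const 1
    have hcent : ∀ t, ∫ v, (w (y t) v - 1) ∂ν = 0 := by
      intro t
      -- A non-integrable function has integral zero by convention, which contradicts mean one.
      have : Integrable (fun v => w (y t) v) ν := by
        by_contra hni
        have := hy1 t
        rw [integral_undef hni] at this
        exact zero_ne_one this
      rw [integral_sub this (integrable_const _), hy1 t]
      simp
    have hsa : |s * a| ≤ |s| := by
      rw [abs_mul, abs_of_nonneg ha]
      exact mul_le_of_le_one_right (abs_nonneg s) ha1
    have k1 := norm_integral_prod_mul_exp_sub_exp_le (ν := ν) (X := fun t v => w (y t) v - 1)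
      hN hj hsa hX (fun t v => by linarith [hw0 (y t) v]) hy6 hcent (hLm y) (hL y)
    have k2 := norm_exp_phaseCoeff_sub_exp_le hj s (H := (∑ t, weightMoment ν w 2 (y t)) / N)
      (v := β⁻¹ * g) ha ha1 haa
      (div_nonneg (Finset.sum_nonneg fun t _ => integral_nonneg fun v => by positivity) hN'.le)
      (by positivity)
    rw [Complex.exp_add] at k2
    have habs : |a * ((∑ t, weightMoment ν w 2 (y t)) / N) - a' * (β⁻¹ * g)|
        ≤ a / N * |∑ t, weightMoment ν w 2 (y t) - T * g| + g * |a * T / N - a' / β| := by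
      -- Split into the fluctuation of the data around `T * g` and the rounding error in `N`.
      have e : a * ((∑ t, weightMoment ν w 2 (y t)) / N) - a' * (β⁻¹ * g)
          = a / N * (∑ t, weightMoment ν w 2 (y t) - T * g) + g * (a * T / N - a' / β) := by
        field_simp
        ring
      rw [e]
      refine (abs_add_le _ _).trans (le_of_eq ?_)
      rw [abs_mul, abs_mul, abs_of_nonneg (by positivity : 0 ≤ a / N), abs_of_nonneg hg0]
    have hrate' : |s * a| / (N : ℝ) ^ 2 + 1 / (N : ℝ) ^ 3 = rate := by
      rw [abs_mul, abs_of_nonneg ha]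
    rw [hrate'] at k1
    refine (norm_sub_le_norm_sub_add_norm_sub _ _ _).trans (add_le_add ?_
      (k2.trans (mul_le_mul_of_nonneg_left habs (by positivity))))
    rw [← mul_sub, norm_mul, ← Complex.ofReal_mul, Complex.norm_exp_ofReal_mul_I, one_mul]
    exact k1
  have i1 : Integrable (fun y : Fin T → E =>
      B * ((∑ t, (1 + weightMoment ν w 6 (y t))) * rate)) (Measure.pi fun _ => μ) :=
    (isum.mul_const _).const_mul _
  have i2 : Integrable (fun y : Fin T → E => a / N * |∑ t, weightMoment ν w 2 (y t) - T * g|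
      + g * |a * T / N - a' / β|) (Measure.pi fun _ => μ) :=
    (iabs.const_mul _).add (integrable_const _)
  refine (integral_mono_of_nonneg (ae_of_all _ fun y => norm_nonneg _)
    (i1.add (i2.const_mul (s ^ 2 + |s|))) hbound).trans ?_
  rw [integral_add' i1 (i2.const_mul _), integral_const_mul,
    integral_const_mul, integral_mul_const, integral_add (iabs.const_mul _) (integrable_const _),
    integral_const_mul, integral_sum_pi i6]
  simp only [integral_const, probReal_univ, smul_eq_mul, one_mul]
  have e1 : T * (∫ y, (1 + weightMoment ν w 6 y) ∂μ) * rate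
      = (∫ y, (1 + weightMoment ν w 6 y) ∂μ) * (T * rate) := by ring
  have e2 : a / N * ∫ y : Fin T → E, |∑ t, weightMoment ν w 2 (y t) - T * g|
        ∂(Measure.pi fun _ => μ) ≤ a * √T / N * (1 + Var[weightMoment ν w 2; μ]) := by
    refine (mul_le_mul_of_nonneg_left habs (by positivity)).trans (le_of_eq ?_)
    ring
  rw [e1]
  gcongr

end RandomWeights


/-! ### Importance weights of the random effects model. -/

instance isProbabilityMeasure_stdNormal (p : ℕ) : IsProbabilityMeasure (stdNormal p) := by
  unfold stdNormal
  infer_instance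

section Model

variable {Θ E : Type*} [MeasurableSpace E] {k p : ℕ} (R : RandomEffectsModel Θ E k)
  (S : ImportanceSampler Θ E k p) (θ : Θ)

lemma lik_nonneg (y : E) : 0 ≤ R.lik θ y :=
  integral_nonneg fun x => mul_nonneg (R.g_nonneg θ y x) (R.f_nonneg θ x)

lemma measurable_lik : Measurable (R.lik θ) :=
  (StronglyMeasurable.integral_prod_right (f := fun y x => R.g θ y x * R.f θ x)
    ((R.g_measurable θ).mul ((R.f_measurable θ).comp measurable_snd)).stronglyMeasurable).measurable

lemma measurable_impWeight :
    Measurable fun z : E × (Fin p → ℝ) => impWeight R S θ z.1 z.2 := by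
  have hΞ : Measurable fun z : E × (Fin p → ℝ) => (z.1, S.Ξ θ z.1 z.2) :=
    measurable_fst.prodMk (S.Ξ_measurable θ)
  exact (((R.g_measurable θ).comp hΞ).mul ((R.f_measurable θ).comp (S.Ξ_measurable θ))).div
    ((S.q_measurable θ).comp hΞ)

lemma measurable_normWeight :
    Measurable fun z : E × (Fin p → ℝ) => normWeight R S θ z.1 z.2 :=
  (measurable_impWeight R S θ).div ((measurable_lik R θ).comp measurable_fst)

lemma normWeight_nonneg (y : E) (u : Fin p → ℝ) : 0 ≤ normWeight R S θ y u :=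
  div_nonneg (div_nonneg (mul_nonneg (R.g_nonneg _ _ _) (R.f_nonneg _ _)) (S.q_nonneg _ _ _))
    (lik_nonneg R θ y)

/-- Unbiasedness of the importance weight. -/
lemma integral_impWeight {y : E} (h : ∀ᵐ x, S.q θ y x = 0 → R.g θ y x * R.f θ x = 0) :
    ∫ u, impWeight R S θ y u ∂(stdNormal p) = R.lik θ y := by
  have hg : Measurable (R.g θ y) := (R.g_measurable θ).comp measurable_prodMk_left
  have hq : Measurable (S.q θ y) := (S.q_measurable θ).comp measurable_prodMk_left
  have hΞ : Measurable (S.Ξ θ y) := (S.Ξ_measurable θ).comp measurable_prodMk_left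
  have hm : Measurable fun x => R.g θ y x * R.f θ x / S.q θ y x :=
    (hg.mul (R.f_measurable θ)).div hq
  have e := integral_map (μ := stdNormal p) hΞ.aemeasurable hm.aestronglyMeasurable
  rw [S.Ξ_law θ y, integral_withDensity_eq_integral_toReal_smul hq.ennreal_ofReal
    (ae_of_all _ fun _ => ENNReal.ofReal_lt_top)] at e
  refine e.symm.trans (integral_congr_ae ?_)
  filter_upwards [h] with x hx
  rw [ENNReal.toReal_ofReal (S.q_nonneg θ y x), smul_eq_mul]
  -- The proposal density cancels the denominator; where it vanishes, division by zero gives zero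
  -- and domination makes the target vanish too.
  by_cases h0 : S.q θ y x = 0
  · rw [h0, zero_mul, hx h0]
  · field_simp

lemma integral_normWeight {y : E} (hy : 0 < R.lik θ y)
    (h : ∀ᵐ x, S.q θ y x = 0 → R.g θ y x * R.f θ x = 0) :
    ∫ u, normWeight R S θ y u ∂(stdNormal p) = 1 := by
  simp only [normWeight]
  rw [integral_div, integral_impWeight R S θ h, div_self hy.ne']

lemma likEst_div_lik {N : ℕ} (hN : 0 < N) (y : E) (u : Fin N → Fin p → ℝ) :
    likEst R S θ y u / R.lik θ y = 1 + avg (fun v => normWeight R S θ y v - 1) u := by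
  have hN' : (N : ℝ) ≠ 0 := by exact_mod_cast hN.ne'
  simp only [likEst, avg, normWeight, Finset.sum_sub_distrib, Finset.sum_const, Finset.card_univ,
    Fintype.card_fin, nsmul_eq_mul, mul_one, ← Finset.sum_div]
  field_simp
  ring

lemma measurable_likEst {T N : ℕ} (t : Fin T) :
    Measurable fun z : (Fin T → E) × (Fin T → Fin N → Fin p → ℝ) =>
      likEst R S θ (z.1 t) (z.2 t) := by
  unfold likEst
  refine (Finset.measurable_sum _ fun i _ => ?_).const_mul _
  exact (measurable_impWeight R S θ).comp
    (f := fun z : (Fin T → E) × (Fin T → Fin N → Fin p → ℝ) => (z.1 t, z.2 t i)) (by fun_prop)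

lemma measurable_loglikError {T N : ℕ} :
    Measurable fun z : (Fin T → E) × (Fin T → Fin N → Fin p → ℝ) =>
      loglikError R S θ z.1 z.2 := by
  unfold loglikError
  refine (Finset.measurable_prod _ fun t _ => measurable_likEst R S θ t).log.sub
    (Finset.measurable_prod _ fun t _ => ?_).log
  exact (measurable_lik R θ).comp ((measurable_pi_apply t).comp measurable_fst)

lemma measurable_loglikError_right {T N : ℕ} (y : Fin T → E) :
    Measurable fun u : Fin T → Fin N → Fin p → ℝ => loglikError R S θ y u :=
  Measurable.comp (g := fun z : (Fin T → E) × (Fin T → Fin N → Fin p → ℝ) =>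
    loglikError R S θ z.1 z.2) (f := fun u => (y, u)) (measurable_loglikError R S θ)
    measurable_prodMk_left

lemma measurable_affine_loglikError {T N : ℕ} (a c : ℝ) :
    Measurable fun z : (Fin T → E) × (Fin T → Fin N → Fin p → ℝ) =>
      a * loglikError R S θ z.1 z.2 + c :=
  ((measurable_loglikError R S θ).const_mul a).add_const c

/-- Positivity of the ratios excludes zero numerators and denominators, so the logarithm of the
quotient splits. -/
lemma loglikError_eq {T N : ℕ} (hN : 0 < N) (y : Fin T → E) (u : Fin T → Fin N → Fin p → ℝ)
    (h : ∀ t, 0 < 1 + avg (fun v => normWeight R S θ (y t) v - 1) (u t)) :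
    loglikError R S θ y u
      = Real.log (∏ t, (1 + avg (fun v => normWeight R S θ (y t) v - 1) (u t))) := by
  simp_rw [← likEst_div_lik R S θ hN] at h ⊢
  have h1 : ∀ t, likEst R S θ (y t) (u t) ≠ 0 := fun t h0 => by
    have := h t
    rw [h0, zero_div] at this
    exact lt_irrefl _ this
  have h2 : ∀ t, R.lik θ (y t) ≠ 0 := fun t h0 => by
    have := h t
    rw [h0, div_zero] at this
    exact lt_irrefl _ this
  rw [loglikError, Finset.prod_div_distrib, Real.log_div (Finset.prod_ne_zero_iff.2 fun t _ => h1 t)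
    (Finset.prod_ne_zero_iff.2 fun t _ => h2 t)]

variable {μ : Measure E} [IsProbabilityMeasure μ]

/-- For a nonnegative weight `x`, `|x - 1| ≤ max 1 x`, hence `(x - 1) ^ 6 ≤ 1 + x ^ n`. -/
lemma integrable_normWeight_sub_one_pow_six {n : ℕ} (hn : 6 ≤ n)
    (h : Integrable (fun z : E × (Fin p → ℝ) => normWeight R S θ z.1 z.2 ^ n)
      (μ.prod (stdNormal p))) :
    Integrable (fun z : E × (Fin p → ℝ) => (normWeight R S θ z.1 z.2 - 1) ^ 6)
      (μ.prod (stdNormal p)) := by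
  refine ((integrable_const 1).add h).mono'
    (((measurable_normWeight R S θ).sub_const 1).pow_const 6).aestronglyMeasurable
    (ae_of_all _ fun z => ?_)
  have h0 := normWeight_nonneg R S θ z.1 z.2
  simp only [Pi.add_apply]
  set x := normWeight R S θ z.1 z.2
  rw [norm_pow, Real.norm_eq_abs]
  rcases le_total x 1 with hx | hx
  · have : |x - 1| ≤ 1 := by rw [abs_le]; constructor <;> linarith
    have := pow_le_one₀ (n := 6) (abs_nonneg _) this
    have := pow_nonneg h0 n
    linarith
  · have : |x - 1| ≤ x := by rw [abs_le]; constructor <;> linarith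
    have := pow_le_pow_left₀ (abs_nonneg _) this 6
    have := pow_le_pow_right₀ hx hn
    linarith

/-- The conditional mean is one for almost every `y`, so in the decomposition of variance only the
average of the conditional variances remains. -/
lemma gammaSq_eq_integral_weightMoment
    (hmean : ∀ᵐ y ∂μ, ∫ u, normWeight R S θ y u ∂(stdNormal p) = 1)
    (h6 : Integrable (fun z : E × (Fin p → ℝ) => (normWeight R S θ z.1 z.2 - 1) ^ 6)
      (μ.prod (stdNormal p))) :
    gammaSq R S μ θ = ∫ y, weightMoment (stdNormal p) (normWeight R S θ) 2 y ∂μ := by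
  have hm := measurable_normWeight R S θ
  have hr : ∀ r ≤ 6, Integrable (fun z : E × (Fin p → ℝ) => (normWeight R S θ z.1 z.2 - 1) ^ r)
      (μ.prod (stdNormal p)) := fun r hr =>
    integrable_pow_of_integrable_pow_six (hm.sub_const 1).aestronglyMeasurable h6 hr
  have hi : Integrable (fun z : E × (Fin p → ℝ) => normWeight R S θ z.1 z.2)
      (μ.prod (stdNormal p)) := by
    refine ((hr 1 (by norm_num)).add (integrable_const 1)).congr (ae_of_all _ fun z => ?_)
    simp
  have h1 : ∫ z, normWeight R S θ z.1 z.2 ∂(μ.prod (stdNormal p)) = 1 := by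
    rw [integral_prod _ hi, integral_congr_ae hmean]
    simp
  rw [gammaSq, variance_eq_integral hm.aemeasurable, h1, integral_prod _ (hr 2 (by norm_num))]
  rfl

end Model

/-! ### The conditional central limit theorem. -/

lemma hasLaw_firstObs {E Ω : Type*} [MeasurableSpace E] [MeasurableSpace Ω] {μ : Measure E}
    {P : Measure Ω} {Y : ℕ → Ω → E} (hYindep : iIndepFun Y P) (hYlaw : ∀ t, HasLaw (Y t) μ P)
    (T : ℕ) : HasLaw (firstObs Y T) (Measure.pi fun _ => μ) P :=
  (hYindep.precomp (g := fun t : Fin T => (t : ℕ)) Fin.val_injective).hasLaw_pi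
    fun t => hYlaw t

section Main

variable {Θ E Ω : Type*} [MeasurableSpace E] [MeasurableSpace Ω] {k p : ℕ}
  {R : RandomEffectsModel Θ E k} {S : ImportanceSampler Θ E k p} {θ : Θ}
  {μ : Measure E} [IsProbabilityMeasure μ] {P : Measure Ω} [IsProbabilityMeasure P]

omit [IsProbabilityMeasure μ] in
-- The conditional laws live on spaces depending on `T`; pulling them back along `X T` gives kernels
-- on the fixed space `Ω`, where they represent the conditional expectations.
lemma condTendstoInLaw_of_charFun {A : ℕ → Type*} [∀ T, MeasurableSpace (A T)]
    {X : (T : ℕ) → Ω → A T} (hX : ∀ T, Measurable (X T)) {ρ : (T : ℕ) → Measure (A T)}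
    (hXlaw : ∀ T, HasLaw (X T) (ρ T) P) {M : ℕ → Ω → ℝ} (hM : ∀ T, AEMeasurable (M T) P)
    {lam : Measure ℝ} [IsProbabilityMeasure lam]
    (h : ∀ s, Tendsto (fun T => ∫ a, ‖charFun (condDistrib (M T) (X T) P a) s - charFun lam s‖
      ∂(ρ T)) atTop (𝓝 0)) :
    CondTendstoInLaw P (fun T => MeasurableSpace.comap (X T) inferInstance) M lam := by
  intro f
  refine (tendstoInMeasure_of_charFun (P := P)
    (κ := fun T => (condDistrib (M T) (X T) P).comap _ (hX T))
    (lam := lam) (fun s => (h s).congr fun T => ?_) f).congr_left fun T => ?_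
  · exact ((hXlaw T).integral_comp (f := fun y =>
      ‖charFun (condDistrib (M T) (X T) P y) s - charFun lam s‖)
      ((measurable_charFun_kernel _ s).sub_const _).norm.aestronglyMeasurable).symm
  · exact (condExp_ae_eq_integral_condDistrib (hX T) (hM T) f.continuous.stronglyMeasurable
      (Integrable.of_bound (f.continuous.comp_aestronglyMeasurable (hM T).aestronglyMeasurable)
        ‖f‖ (ae_of_all _ fun ω => f.norm_coe_le_norm _))).symm

/-- Quantitative bound between the conditional characteristic function of the rescaled and
recentred loglikelihood error and the Gaussian one. -/
lemma integral_norm_charFun_condDistrib_loglikError_le {j : ℕ} (hj : j ≤ 1)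
    (hmean : ∀ᵐ y ∂μ, ∫ u, normWeight R S θ y u ∂(stdNormal p) = 1)
    (h6 : Integrable (fun z : E × (Fin p → ℝ) => (normWeight R S θ z.1 z.2 - 1) ^ 6)
      (μ.prod (stdNormal p)))
    {T N : ℕ} (hT : 0 < T) (hN : 0 < N) (s : ℝ) {a a' β : ℝ} (ha : 0 ≤ a) (ha1 : a ≤ 1)
    (haa : a * a' = 1) (hβ : 0 < β) {X : Ω → Fin T → E}
    (hX : HasLaw X (Measure.pi fun _ => μ) P) {U : Ω → Fin T → Fin N → Fin p → ℝ}
    (hU : HasLaw (fun ω => (X ω, U ω)) ((proposalLaw μ p T N).withDensity fun z =>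
        ENNReal.ofReal (∏ t, (likEst R S θ (z.1 t) (z.2 t) / R.lik θ (z.1 t)) ^ j)) P) :
    ∫ y, ‖charFun (condDistrib (fun ω => a * loglikError R S θ (X ω) (U ω)
            + -(2 * j - 1) * (a' * (β⁻¹ * gammaSq R S μ θ) / 2)) X P y) s
        - charFun (gaussianReal 0 (β⁻¹ * gammaSq R S μ θ).toNNReal) s‖
        ∂(Measure.pi fun _ : Fin T => μ)
      ≤ (30 + 4096 * (3 + |s|) ^ 3)
          * ((∫ y, (1 + weightMoment (stdNormal p) (normWeight R S θ) 6 y) ∂μ)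
            * (T * (|s| * a / N ^ 2 + 1 / N ^ 3)))
        + (s ^ 2 + |s|) * (a * √T / N
            * (1 + Var[weightMoment (stdNormal p) (normWeight R S θ) 2; μ])
          + gammaSq R S μ θ * |a * T / N - a' / β|) := by
  have hcore := integral_norm_condCharFun_sub_le (μ := μ) (ν := stdNormal p)
    (w := normWeight R S θ) hT hN hj s ha ha1 haa hβ
    (measurable_normWeight R S θ) (normWeight_nonneg R S θ) hmean h6
    (L := fun y u => loglikError R S θ y u)
    (measurable_loglikError_right R S θ)
    (fun y u => loglikError_eq R S θ hN y u)
  have hg0 : 0 ≤ ∫ y, weightMoment (stdNormal p) (normWeight R S θ) 2 y ∂μ :=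
    integral_nonneg fun y => integral_nonneg fun v => by positivity
  rw [← gammaSq_eq_integral_weightMoment R S θ hmean h6] at hcore hg0
  refine le_trans (le_of_eq (integral_congr_ae ?_)) hcore
  have hD : Measurable fun z : (Fin T → E) × (Fin T → Fin N → Fin p → ℝ) =>
      ∏ t, (likEst R S θ (z.1 t) (z.2 t) / R.lik θ (z.1 t)) ^ j :=
    Finset.measurable_prod _ fun t _ => ((measurable_likEst R S θ t).div
      ((measurable_lik R θ).comp ((measurable_pi_apply t).comp measurable_fst))).pow_const j
  have hD0 : ∀ z : (Fin T → E) × (Fin T → Fin N → Fin p → ℝ),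
      0 ≤ ∏ t, (likEst R S θ (z.1 t) (z.2 t) / R.lik θ (z.1 t)) ^ j := fun z =>
    Finset.prod_nonneg fun t _ => by
      rw [likEst_div_lik R S θ hN]
      have := neg_one_le_avg hN (X := fun v => normWeight R S θ (z.1 t) v - 1)
        (fun v => by linarith [normWeight_nonneg R S θ (z.1 t) v]) (z.2 t)
      exact pow_nonneg (by linarith) j
  have hchar := charFun_condDistrib_of_hasLaw_withDensity hD hD0 hX hU
    (G := fun z => a * loglikError R S θ z.1 z.2
      + -(2 * j - 1) * (a' * (β⁻¹ * gammaSq R S μ θ) / 2))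
    (measurable_affine_loglikError R S θ _ _) s
  filter_upwards [hchar] with y hy
  rw [hy, charFun_gaussianReal, ← integral_const_mul]
  congr 2
  -- The recentring constant does not depend on `u`, so it factors out as a phase.
  · refine integral_congr_ae (ae_of_all _ fun u => ?_)
    simp only [likEst_div_lik R S θ hN]
    rw [mul_left_comm (Complex.exp _), ← Complex.exp_add]
    congr 2
    push_cast
    ring
  · congr 1
    rw [Real.coe_toNNReal _ (mul_nonneg (inv_nonneg.2 hβ.le) hg0)]
    push_cast
    ring

end Main


section Main

variable {Θ E Ω : Type*} [MeasurableSpace E] [MeasurableSpace Ω] {k p : ℕ}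
  {R : RandomEffectsModel Θ E k} {S : ImportanceSampler Θ E k p} {θ : Θ}
  {μ : Measure E} [IsProbabilityMeasure μ] {P : Measure Ω} [IsProbabilityMeasure P]

omit [IsProbabilityMeasure P] in
lemma aemeasurable_affine_loglikError {T N : ℕ} {X : Ω → Fin T → E}
    {U : Ω → Fin T → Fin N → Fin p → ℝ} (h : AEMeasurable (fun ω => (X ω, U ω)) P) (a c : ℝ) :
    AEMeasurable (fun ω => a * loglikError R S θ (X ω) (U ω) + c) P := by
  have := (measurable_affine_loglikError R S θ a c (T := T) (N := N)).comp_aemeasurable h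
  exact this

/-- Conditional central limit theorem for the loglikelihood error when the law of the auxiliary
variables has density `∏ₜ (p̂(Y_t | θ, u_t) / p(Y_t | θ)) ^ j` for `j = 0` or `j = 1`, for scalings
`a T = (a' T)⁻¹` and numbers of samples `N T` such that the error terms vanish. -/
lemma condTendstoInLaw_loglikError_of_tendsto {j : ℕ} (hj : j ≤ 1)
    (hmean : ∀ᵐ y ∂μ, ∫ u, normWeight R S θ y u ∂(stdNormal p) = 1)
    (h6 : Integrable (fun z : E × (Fin p → ℝ) => (normWeight R S θ z.1 z.2 - 1) ^ 6)
      (μ.prod (stdNormal p)))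
    {N : ℕ → ℕ} {a a' : ℕ → ℝ} {β : ℝ} (hβ : 0 < β) (hN : ∀ T, 0 < T → 0 < N T)
    (ha : ∀ T, 0 < T → 0 ≤ a T ∧ a T ≤ 1 ∧ a T * a' T = 1)
    (hrate : ∀ s : ℝ, Tendsto (fun T : ℕ => (T : ℝ) * (|s| * a T / (N T : ℝ) ^ 2
      + 1 / (N T : ℝ) ^ 3)) atTop (𝓝 0))
    (hsqrt : Tendsto (fun T : ℕ => a T * √T / N T) atTop (𝓝 0))
    (hround : Tendsto (fun T : ℕ => |a T * T / N T - a' T / β|) atTop (𝓝 0))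
    {Y : ℕ → Ω → E} (hYmeas : ∀ t, Measurable (Y t))
    (hYindep : iIndepFun Y P) (hYlaw : ∀ t, HasLaw (Y t) μ P)
    {U : (T : ℕ) → Ω → Fin T → Fin (N T) → Fin p → ℝ}
    (hU : ∀ T, HasLaw (fun ω => (firstObs Y T ω, U T ω))
      ((proposalLaw μ p T (N T)).withDensity fun z =>
        ENNReal.ofReal (∏ t, (likEst R S θ (z.1 t) (z.2 t) / R.lik θ (z.1 t)) ^ j)) P) :
    CondTendstoInLaw P (obsSigma Y)
      (fun T ω => a T * loglikError R S θ (firstObs Y T ω) (U T ω)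
        + -(2 * j - 1) * (a' T * (β⁻¹ * gammaSq R S μ θ) / 2))
      (gaussianReal 0 (β⁻¹ * gammaSq R S μ θ).toNNReal) := by
  have hX : ∀ T, Measurable (firstObs Y T) := fun T =>
    measurable_pi_lambda _ fun t => hYmeas t
  have hXlaw := hasLaw_firstObs hYindep hYlaw
  have hM : ∀ T : ℕ, AEMeasurable (fun ω => a T * loglikError R S θ (firstObs Y T ω) (U T ω)
        + -(2 * j - 1) * (a' T * (β⁻¹ * gammaSq R S μ θ) / 2)) P := fun T =>
    aemeasurable_affine_loglikError (hU T).aemeasurable _ _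
  refine condTendstoInLaw_of_charFun hX hXlaw hM fun s => ?_
  have hlim := ((((hrate s).const_mul
      (∫ y, (1 + weightMoment (stdNormal p) (normWeight R S θ) 6 y) ∂μ)).const_mul
      (30 + 4096 * (3 + |s|) ^ 3))).add
      (((hsqrt.mul_const
        (1 + Var[weightMoment (stdNormal p) (normWeight R S θ) 2; μ])).add
        (hround.const_mul (gammaSq R S μ θ))).const_mul (s ^ 2 + |s|))
  simp only [mul_zero, zero_mul, add_zero] at hlim
  refine squeeze_zero' (Eventually.of_forall fun T => integral_nonneg fun y => norm_nonneg _) ?_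
    hlim
  filter_upwards [eventually_gt_atTop 0] with T hT
  obtain ⟨ha0, ha1, haa⟩ := ha T hT
  exact integral_norm_charFun_condDistrib_loglikError_le hj hmean h6 hT (hN T hT) s ha0 ha1 haa hβ
    (hXlaw T) (hU T)

lemma condTendstoInLaw_loglikError {j : ℕ} (hj : j ≤ 1)
    (hmean : ∀ᵐ y ∂μ, ∫ u, normWeight R S θ y u ∂(stdNormal p) = 1)
    (h6 : Integrable (fun z : E × (Fin p → ℝ) => (normWeight R S θ z.1 z.2 - 1) ^ 6)
      (μ.prod (stdNormal p)))
    {α β : ℝ} (hα : 1 / 3 < α) (hα' : α ≤ 1) (hβ : 0 < β)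
    {Y : ℕ → Ω → E} (hYmeas : ∀ t, Measurable (Y t))
    (hYindep : iIndepFun Y P) (hYlaw : ∀ t, HasLaw (Y t) μ P)
    {U : (T : ℕ) → Ω → Fin T → Fin (numSamples β α T) → Fin p → ℝ}
    (hU : ∀ T, HasLaw (fun ω => (firstObs Y T ω, U T ω))
      ((proposalLaw μ p T (numSamples β α T)).withDensity fun z =>
        ENNReal.ofReal (∏ t, (likEst R S θ (z.1 t) (z.2 t) / R.lik θ (z.1 t)) ^ j)) P) :
    CondTendstoInLaw P (obsSigma Y)
      (fun T ω => (T : ℝ) ^ ((α - 1) / 2) * loglikError R S θ (firstObs Y T ω) (U T ω)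
        + -(2 * j - 1) * ((T : ℝ) ^ ((1 - α) / 2) * (β⁻¹ * gammaSq R S μ θ) / 2))
      (gaussianReal 0 (β⁻¹ * gammaSq R S μ θ).toNNReal) :=
  condTendstoInLaw_loglikError_of_tendsto hj hmean h6 (N := numSamples β α) hβ
    (fun _ hT => numSamples_pos hβ hT)
    -- The scale `T ^ ((α - 1) / 2)` is at most one because `α ≤ 1`, which keeps `|b| ≤ |s|`.
    (fun T hT => ⟨by positivity,
      Real.rpow_le_one_of_one_le_of_nonpos (by exact_mod_cast hT) (by linarith),
      by rw [← Real.rpow_add (by exact_mod_cast hT), show (α - 1) / 2 + (1 - α) / 2 = 0 by ring,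
        Real.rpow_zero]⟩)
    (tendsto_error_rate hα hβ) (tendsto_sqrt_mul_rpow_div_numSamples hα hβ)
    (tendsto_rounding_error hα hβ) hYmeas hYindep hYlaw hU

end Main

end

theorem theorem1 {Θ E Ω : Type*} [MeasurableSpace E] [MeasurableSpace Ω] {k p : ℕ}
    (R : RandomEffectsModel Θ E k) (S : ImportanceSampler Θ E k p) (θ : Θ)
    (μ : Measure E) [IsProbabilityMeasure μ]
    -- the likelihood is positive and finite, and the proposal dominates, for `μ`-almost every `y`
    (hlik : ∀ᵐ y ∂μ, 0 < R.lik θ y)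
    (hsupp : ∀ᵐ y ∂μ, ∀ᵐ x, S.q θ y x = 0 → R.g θ y x * R.f θ x = 0)
    (α β : ℝ) (hα : 1 / 3 < α) (hα' : α ≤ 1) (hβ : 0 < β)
    (P : Measure Ω) [IsProbabilityMeasure P]
    (Y : ℕ → Ω → E) (hYmeas : ∀ t, Measurable (Y t))
    (hYindep : iIndepFun Y P) (hYlaw : ∀ t, HasLaw (Y t) μ P)
    (U : (T : ℕ) → Ω → Fin T → Fin (numSamples β α T) → Fin p → ℝ) :
    -- `U ∼ m`
    (Integrable (fun z : E × (Fin p → ℝ) => normWeight R S θ z.1 z.2 ^ 8)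
        (μ.prod (stdNormal p)) →
      (∀ T, HasLaw (fun ω => (firstObs Y T ω, U T ω))
        (proposalLaw μ p T (numSamples β α T)) P) →
      CondTendstoInLaw P (obsSigma Y)
        (fun T ω =>
          (T : ℝ) ^ ((α - 1) / 2) * loglikError R S θ (firstObs Y T ω) (U T ω)
            + 1 / 2 * (T : ℝ) ^ ((1 - α) / 2) * β⁻¹ * gammaSq R S μ θ)
        (gaussianReal 0 (β⁻¹ * gammaSq R S μ θ).toNNReal)) ∧
    -- `U ∼ π̄(· | θ)`
    (Integrable (fun z : E × (Fin p → ℝ) => normWeight R S θ z.1 z.2 ^ 9)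
        (μ.prod (stdNormal p)) →
      Integrable (fun y => condGammaSq R S θ y ^ 2) μ →
      (∀ T, HasLaw (fun ω => (firstObs Y T ω, U T ω))
        (equilibriumLaw R S μ θ T (numSamples β α T)) P) →
      CondTendstoInLaw P (obsSigma Y)
        (fun T ω =>
          (T : ℝ) ^ ((α - 1) / 2) * loglikError R S θ (firstObs Y T ω) (U T ω)
            - 1 / 2 * (T : ℝ) ^ ((1 - α) / 2) * β⁻¹ * gammaSq R S μ θ)
        (gaussianReal 0 (β⁻¹ * gammaSq R S μ θ).toNNReal)) := by
  have hmean : ∀ᵐ y ∂μ, ∫ u, normWeight R S θ y u ∂(stdNormal p) = 1 := by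
    filter_upwards [hlik, hsupp] with y h1 h2
    exact integral_normWeight R S θ h1 h2
  refine ⟨fun h8 hU => ?_, fun h9 _ hU => ?_⟩
  · have h6 := integrable_normWeight_sub_one_pow_six R S θ (by norm_num) h8
    -- With exponent zero the density is one and the joint law is `proposalLaw`.
    have key := condTendstoInLaw_loglikError (j := 0) (by norm_num) hmean h6 hα hα' hβ hYmeas
      hYindep hYlaw (U := U) fun T => by
        simpa using hU T
    refine cast (congrArg (fun M => CondTendstoInLaw P (obsSigma Y) M _) ?_) key
    ext T ω
    push_cast
    ring
  · have h6 := integrable_normWeight_sub_one_pow_six R S θ (by norm_num) h9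
    -- With exponent one the density is that of `equilibriumLaw`, and the recentring changes sign.
    have key := condTendstoInLaw_loglikError (j := 1) le_rfl hmean h6 hα hα' hβ hYmeas
      hYindep hYlaw (U := U) fun T => by
        simpa [equilibriumLaw] using hU T
    refine cast (congrArg (fun M => CondTendstoInLaw P (obsSigma Y) M _) ?_) key
    ext T ω
    push_cast
    ring
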